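/- Let $\mu$ be the normalised Haar measure on $\mathrm{SU}(2)$, and let ${\bm Z}_1,{\bm Z}_2,{\bm Z}_3$ be the left-invariant vector fields on $\mathrm{SU}(2)$ generated by $-\tfrac{i}{2}\sigma_j$ ($\sigma_j$ the Pauli matrices), so that $[{\bm Z}_i,{\bm Z}_j]=\epsilon_{ijk}{\bm Z}_k$. Put ${\bm X}_\pm = -({\bm Z}_2 \pm i {\bm Z}_1)$ and ${\bm Z}^\alpha = {\bm Z}_1^{\alpha_1}{\bm Z}_2^{\alpha_2}{\bm Z}_3^{\alpha_3}$ for a multi-index $\alpha$. For $\varepsilon\in(0,1)$, $\rho_\star>0$, $\tau_\star\in(-1,1)$ and $t\in(\tau_\star,1]$ let \[ \mathcal{N}_t = \Big\{(\tau,\rho,g)\in[-1,1]\times[0,\infty)\times\mathrm{SU}(2) : \tau_\star\le\tau\le t,\ 0\le\rho\le \tfrac{2\varepsilon}{2-\varepsilon}\,\tfrac{\rho_\star}{1+\tau}\Big\}, \qquad \mathcal{S}_\star = \mathcal{N}_t\cap\{\tau=\tau_\star\}. \] For all $\tau_\star\in(-1,1)$ and all non-negative integers $p,m$ with $p>m+1$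 there is a constant $C_{p,m}>0$, depending only on $p$, $m$ and $\tau_\star$ (in particular independent of $t$), such that the following holds for all $\varepsilon\in(0,1)$, $\rho_\star>0$ and $t\in(\tau_\star,1]$. Let $\psi,\psi_0,\psi_1,\psi_2$ be complex-valued functions that, at all points of $\mathcal{N}_t$ with $\tau<1$ and $\rho>0$, are of class $C^{p+m+1}$ (up to and slightly across the remaining boundary) and satisfy the transport hierarchy \begin{align*} &(1+\tau)\partial_\tau\psi_2-\rho\partial_\rho\psi_2-\tfrac12{\bm X}_-\psi-{\bm X}_-\psi_1=0,\\ &(1-\tau)\partial_\tau\psi_1+\rho\partial_\rho\psi_1+\tfrac12\big((1-\tau)\partial_\tau\psi+\rho\partial_\rho\psi\big)-{\bm X}_+\psi_2-\tfrac12\psi-\psi_1=0,\\ &(1+\tau)\partial_\tau\psi_1-\rho\partial_\rho\psi_1-\tfrac12\big((1+\tau)\partial_\tau\psi-\rho\partial_\rho\psi\big)-{\bm X}_-\psi_0-\tfrac12\psi+\psi_1=0,\\ &(1-\tau)\partial_\tau\psi_0+\rho\partial_\rho\psi_0+\tfrac12{\bm X}_+\psi-{\bm X}_+\psi_1=0.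 \end{align*} If \[ \mathcal{E}_\star := \int_{\mathcal{S}_\star}\sum_{p'+q'+|\alpha|\le m}\Big(\sum_{k=0}^2|\partial_\rho^{p'}\partial_\tau^{q'}{\bm Z}^\alpha\partial_\rho^p\psi_k|^2+|\partial_\rho^{p'}\partial_\tau^{q'}{\bm Z}^\alpha\partial_\rho^p\psi|^2\Big)\,\mathrm{d}\rho\,\mathrm{d}\mu<\infty, \] then \[ \sum_{k=0}^2\|\partial_\rho^p\psi_k\|^2_{H^m(\mathcal{N}_t)}+\|\partial_\rho^p\psi\|^2_{H^m(\mathcal{N}_t)}\le C_{p,m}\,\mathcal{E}_\star, \] where \[ \|f\|^2_{H^m(\mathcal{N}_t)}=\int_{\mathcal{N}_t}\sum_{p'+q'+|\alpha|\le m}|\partial_\rho^{p'}\partial_\tau^{q'}{\bm Z}^\alpha f|^2\,\mathrm{d}\tau\,\mathrm{d}\rho\,\mathrm{d}\mu. \] -/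

import Mathlib

open MeasureTheory Set Topology
open scoped ENNReal

noncomputable section

namespace FGauge

/-- The group `SU(2)` of unitary `2 × 2` complex matrices of determinant one. -/
abbrev SU2 : Type := Matrix.specialUnitaryGroup (Fin 2) ℂ

instance instIsTopologicalGroupSU2 : IsTopologicalGroup SU2 where
  continuous_mul := by
    refine Continuous.subtype_mk ?_ _
    exact (continuous_subtype_val.comp continuous_fst).mul
      (continuous_subtype_val.comp continuous_snd)
  continuous_inv := by
    refine Continuous.subtype_mk ?_ _
    exact Continuous.star continuous_subtype_val

instance instCompactSpaceSU2 : CompactSpace SU2 := by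
  have hK : IsCompact {A : Matrix (Fin 2) (Fin 2) ℂ | ∀ i j, ‖A i j‖ ≤ 1} := by
    have h : {A : Matrix (Fin 2) (Fin 2) ℂ | ∀ i j, ‖A i j‖ ≤ 1} =
        Set.pi univ fun _ : Fin 2 => Set.pi univ fun _ : Fin 2 => Metric.closedBall (0 : ℂ) 1 := by
      ext A
      exact ⟨fun h i _ j _ => by simpa using h i j,
        fun h i j => by simpa using h i trivial j trivial⟩
    rw [h]
    exact isCompact_univ_pi fun _ => isCompact_univ_pi fun _ => isCompact_closedBall 0 1
  have hc : IsClosed {A : Matrix (Fin 2) (Fin 2) ℂ | star A * A = 1 ∧ A.det = 1} := by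
    refine IsClosed.and ?_ ?_
    · exact isClosed_eq ((Continuous.star continuous_id).mul continuous_id) continuous_const
    · exact isClosed_eq (Continuous.matrix_det continuous_id) continuous_const
  have hs : ((Matrix.specialUnitaryGroup (Fin 2) ℂ : Submonoid _) :
      Set (Matrix (Fin 2) (Fin 2) ℂ)) =
      {A | ∀ i j, ‖A i j‖ ≤ 1} ∩ {A | star A * A = 1 ∧ A.det = 1} := by
    ext A
    simp only [SetLike.mem_coe, Matrix.mem_specialUnitaryGroup_iff, mem_inter_iff, mem_ofPred_eq,
      Matrix.mem_unitaryGroup_iff']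
    refine ⟨fun h => ⟨fun i j => ?_, h⟩, fun h => h.2⟩
    exact entry_norm_bound_of_unitary (Matrix.mem_unitaryGroup_iff'.2 h.1) i j
  exact isCompact_iff_compactSpace.1 (hs ▸ hK.inter_right hc)

instance instMeasurableSpaceSU2 : MeasurableSpace SU2 := borel SU2

instance instBorelSpaceSU2 : BorelSpace SU2 := ⟨rfl⟩

/-- The normalised Haar measure on `SU(2)`. -/
def haarSU2 : Measure SU2 := Measure.haarMeasure ⊤

/-- The Haar measure `haarSU2` has total mass one. -/
theorem haarSU2_univ : haarSU2 univ = 1 := by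
  have h := Measure.haarMeasure_self (G := SU2) (K₀ := ⊤)
  rwa [TopologicalSpace.PositiveCompacts.coe_top] at h

/-- Points `(τ, ρ, g)` of `ℝ × ℝ × SU(2)`. -/
abbrev Pt : Type := ℝ × ℝ × SU2

/-- Complex scalar fields (only their values near the region of interest matter). -/
abbrev Field : Type := Pt → ℂ

/-- The Pauli matrices `σ₁, σ₂, σ₃`, indexed by `0, 1, 2`. -/
def pauli : Fin 3 → Matrix (Fin 2) (Fin 2) ℂ :=
  ![!![0, 1; 1, 0], !![0, -Complex.I; Complex.I, 0], !![1, 0; 0, -1]]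

/-- The matrix `cos (s/2) - i sin (s/2) σⱼ`, which equals `exp (s uⱼ)` with `uⱼ = -(i/2) σⱼ`. -/
def oneParamMatrix (j : Fin 3) (s : ℝ) : Matrix (Fin 2) (Fin 2) ℂ :=
  (Complex.cos (s / 2)) • (1 : Matrix (Fin 2) (Fin 2) ℂ) -
    (Complex.I * Complex.sin (s / 2)) • pauli j

theorem oneParamMatrix_mem (j : Fin 3) (s : ℝ) :
    oneParamMatrix j s ∈ Matrix.specialUnitaryGroup (Fin 2) ℂ := by
  have h := Complex.sin_sq_add_cos_sq ((s : ℂ) / 2)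
  have hc : (starRingEnd ℂ) (Complex.cos ((s : ℂ) / 2)) = Complex.cos ((s : ℂ) / 2) := by
    rw [← Complex.cos_conj, map_div₀, Complex.conj_ofReal, Complex.conj_ofNat]
  have hs : (starRingEnd ℂ) (Complex.sin ((s : ℂ) / 2)) = Complex.sin ((s : ℂ) / 2) := by
    rw [← Complex.sin_conj, map_div₀, Complex.conj_ofReal, Complex.conj_ofNat]
  have hI := Complex.I_sq
  rw [Matrix.mem_specialUnitaryGroup_iff, Matrix.mem_unitaryGroup_iff]
  constructor
  · ext a b
    fin_cases j <;> fin_cases a <;> fin_cases b <;>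
      simp [oneParamMatrix, pauli, Matrix.mul_apply, Fin.sum_univ_two, Matrix.star_apply, hc, hs] <;>
      grind
  · fin_cases j <;> simp [oneParamMatrix, pauli, Matrix.det_fin_two] <;> grind

/-- The one-parameter subgroup `s ↦ exp (s uⱼ)` of `SU(2)`, where `uⱼ = -(i/2) σⱼ`, so that
`[u₁, u₂] = u₃` and cyclically. -/
def oneParam (j : Fin 3) (s : ℝ) : SU2 := ⟨oneParamMatrix j s, oneParamMatrix_mem j s⟩

/-- `∂_τ` -/
def dτ (f : Field) : Field := fun x => deriv (fun s : ℝ => f (s, x.2.1, x.2.2)) x.1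

/-- `∂_ρ` -/
def dρ (f : Field) : Field := fun x => deriv (fun s : ℝ => f (x.1, s, x.2.2)) x.2.1

/-- The left-invariant vector fields `Z₁, Z₂, Z₃` on `SU(2)` (indexed by `0, 1, 2`),
`(Zⱼ f)(g) = d/ds f (g exp (s uⱼ))` at `s = 0`; they satisfy `[Zᵢ, Zⱼ] = εᵢⱼₖ Zₖ`. -/
def Z (j : Fin 3) (f : Field) : Field :=
  fun x => deriv (fun s : ℝ => f (x.1, x.2.1, x.2.2 * oneParam j s)) 0

/-- `X₊ = -(Z₂ + i Z₁)` -/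
def Xplus (f : Field) : Field := fun x => -(Z 1 f x + Complex.I * Z 0 f x)

/-- `X₋ = -(Z₂ - i Z₁)` -/
def Xminus (f : Field) : Field := fun x => -(Z 1 f x - Complex.I * Z 0 f x)

/-- `∂_ρ^{p'} ∂_τ^{q'} Z₁^{α₁} Z₂^{α₂} Z₃^{α₃}`, where `n = (p', q', α₁, α₂, α₃)`. -/
def D (n : ℕ × ℕ × ℕ × ℕ × ℕ) (f : Field) : Field :=
  dρ^[n.1] (dτ^[n.2.1] ((Z 0)^[n.2.2.1] ((Z 1)^[n.2.2.2.1] ((Z 2)^[n.2.2.2.2] f))))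

/-- The indices `(p', q', α₁, α₂, α₃)` with `p' + q' + |α| ≤ m`. -/
def indices (m : ℕ) : Finset (ℕ × ℕ × ℕ × ℕ × ℕ) :=
  (Finset.range (m + 1) ×ˢ Finset.range (m + 1) ×ˢ Finset.range (m + 1) ×ˢ
    Finset.range (m + 1) ×ˢ Finset.range (m + 1)).filter
      fun n => n.1 + n.2.1 + (n.2.2.1 + n.2.2.2.1 + n.2.2.2.2) ≤ m

theorem mem_indices {m : ℕ} {n : ℕ × ℕ × ℕ × ℕ × ℕ} :
    n ∈ indices m ↔ n.1 + n.2.1 + (n.2.2.1 + n.2.2.2.1 + n.2.2.2.2) ≤ m := by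
  simp only [indices, Finset.mem_filter, Finset.mem_product, Finset.mem_range]
  omega

/-- The density `∑_{p' + q' + |α| ≤ m} |∂_ρ^{p'} ∂_τ^{q'} Z^α f|²`. -/
def density (m : ℕ) (f : Field) (x : Pt) : ℝ≥0∞ := ∑ n ∈ indices m, ‖D n f x‖ₑ ^ 2

/-- The outer boundary value of `ρ` on the slice of constant `τ`. -/
def ρmax (ε ρs τ : ℝ) : ℝ := (2 * ε / (2 - ε)) * (ρs / (1 + τ))

/-- The domain `N_t`, with initial time `τs`. -/
def domain (ε ρs τs t : ℝ) : Set Pt :=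
  {x | τs ≤ x.1 ∧ x.1 ≤ t ∧ 0 ≤ x.2.1 ∧ x.2.1 ≤ ρmax ε ρs x.1}

/-- The measure `dτ dρ dμ`. -/
def dv : Measure Pt := (volume : Measure ℝ).prod ((volume : Measure ℝ).prod haarSU2)

/-- The squared Sobolev norm `‖f‖²_{H^m(N)}` (possibly infinite) on `N ⊆ ℝ × ℝ × SU(2)`. -/
def sobolevSq (m : ℕ) (N : Set Pt) (f : Field) : ℝ≥0∞ := ∫⁻ x in N, density m f x ∂dv

/-- `∫_{S_τ} ∑_{p' + q' + |α| ≤ m} |∂_ρ^{p'} ∂_τ^{q'} Z^α f|² dρ dμ` over the slice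
`S_τ = {τ} × [0, ρmax] × SU(2)`. -/
def sliceSq (ε ρs : ℝ) (m : ℕ) (τ : ℝ) (f : Field) : ℝ≥0∞ :=
  ∫⁻ y in Icc 0 (ρmax ε ρs τ) ×ˢ (univ : Set SU2), density m f (τ, y)
    ∂((volume : Measure ℝ).prod haarSU2)

/-- `f` is of class `C^k` near the point `x` of the submanifold `ℝ × ℝ × SU(2)` of the vector space
`ℝ × ℝ × M₂(ℂ)`: near `x` it is the restriction of a function that is `C^k` at `x`. -/
def CkAt (k : ℕ) (f : Field) (x : Pt) : Prop :=
  ∃ F : ℝ × ℝ × (Fin 2 → Fin 2 → ℂ) → ℂ,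
    ContDiffAt ℝ k F (x.1, x.2.1, fun a b => x.2.2.1 a b) ∧
      ∀ᶠ y in 𝓝 x, f y = F (y.1, y.2.1, fun a b => y.2.2.1 a b)

/-- The transport hierarchy `A₀ = B₀ = A₁ = B₁ = 0` for `ψ` and `(ψ₀, ψ₁, ψ₂) = (ψk 0, ψk 1, ψk 2)` at the point
`x = (τ, ρ, g)`. -/
structure TransportAt (ψ : Field) (ψk : Fin 3 → Field) (x : Pt) : Prop where
  A0 : (1 + x.1) * dτ (ψk 2) x - x.2.1 * dρ (ψk 2) x - 1 / 2 * Xminus ψ x - Xminus (ψk 1) x = 0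
  B0 : (1 - x.1) * dτ (ψk 1) x + x.2.1 * dρ (ψk 1) x
    + 1 / 2 * ((1 - x.1) * dτ ψ x + x.2.1 * dρ ψ x) - Xplus (ψk 2) x - 1 / 2 * ψ x - ψk 1 x = 0
  A1 : (1 + x.1) * dτ (ψk 1) x - x.2.1 * dρ (ψk 1) x
    - 1 / 2 * ((1 + x.1) * dτ ψ x - x.2.1 * dρ ψ x) - Xminus (ψk 0) x - 1 / 2 * ψ x + ψk 1 x = 0
  B1 : (1 - x.1) * dτ (ψk 0) x + x.2.1 * dρ (ψk 0) x + 1 / 2 * Xplus ψ x - Xplus (ψk 1) x = 0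

end FGauge

end

/-! Write T₊ = (1+τ)∂_τ − ρ∂_ρ and T₋ = (1−τ)∂_τ + ρ∂_ρ. In the unknowns ψ₁ ± ½ψ the hierarchy
decouples into two pairs, (u, v) = (ψ₂, ψ₁ + ½ψ) and (ψ₁ − ½ψ, ψ₀), each of the form T₊u = c₁u +
X₋v, T₋v = c₂v + X₊u with c₁ ≤ 0 and c₂ ≤ 1 (`TransportAt.transport_two` and its companions).

Apply `W p n` = ∂_ρ^{p'} ∂_τ^{q'} Z^α ∂_ρ^p. Each ∂_ρ shifts the zero-order coefficient in T₊ by +1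
and that in T₋ by −1, and ∂_τ does the opposite (`W_transport`). For U = W u and V = W v this gives
T₊U = (p+p'−q'+c₁)U + X₋V + R and T₋V = −(p+p'−q'−c₂)V + X₊U + R', where R and R' are commutators
[W, X∓] and cost no derivative, by reordering of monomials in the Z_j (`exists_bound_W_Z_comm`). As
p > m+1, the coefficient of V is at most −1. This damping is what the estimate needs up to τ = 1:
there the factor 1−τ in front of ∂_τ degenerates, so no exponential weight in τ can absorb |V|².
Terms in |U|² are harmless, because 1+τ is bounded below by 1+τ_⋆.

In 2 Re(Ū T₊U + V̄ T₋V) the cross terms combine into 2 Re X₊(U V̄), whose Haar integral vanishes.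
With A = Σ|U|² and B = Σ|V|² one obtains T₊A + T₋B ≤ C A − B + 2 Re X₊S
(`exists_energy_inequality`). The left side is the divergence ∂_τ((1+τ)A + (1−τ)B) + ∂_ρ(ρ(B−A)). A
weight e^{−l(τ−τ_⋆)} turns C A into −A, and integration bounds ∫(A+B) by data
(`integral_energy_le`).

No regularity is available at ρ = 0 or τ = 1, so the weight also carries cutoffs in the
characteristic variables ρ(1+τ) and ρ(1−τ). The transport derivatives of the cutoffs have a
favourable sign (`exists_transport_weightField`), so the bound is uniform in the cutoff width, and
monotone convergence gives the whole domain (`lintegral_region_le`). -/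

noncomputable section

namespace FGauge

/-! ### Vector fields and flows on ℝ × ℝ × SU(2), seen in the ambient vector space -/

/-- The vector space in which `ℝ × ℝ × SU(2)` is embedded. -/
abbrev Amb : Type := ℝ × ℝ × (Fin 2 → Fin 2 → ℂ)

/-- The embedding of `ℝ × ℝ × SU(2)` in its ambient vector space. -/
def emb (x : Pt) : Amb := (x.1, x.2.1, fun a b => x.2.2.1 a b)

theorem continuous_emb : Continuous emb := by
  refine continuous_fst.prodMk (continuous_snd.fst.prodMk ?_)
  have h : Continuous fun x : Pt => x.2.2.1 := continuous_snd.snd.subtype_val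
  exact h

/-- The directions of differentiation on `ℝ × ℝ × SU(2)`. -/
inductive Dir : Type
  | τ : Dir
  | ρ : Dir
  | z : Fin 3 → Dir

/-- The derivative in a given direction. -/
def pd : Dir → Field → Field
  | .τ => dτ
  | .ρ => dρ
  | .z j => Z j

/-- The flow of the vector field belonging to a direction. -/
def flow : Dir → Pt → ℝ → Pt
  | .τ, x, s => (x.1 + s, x.2)
  | .ρ, x, s => (x.1, x.2.1 + s, x.2.2)
  | .z j, x, s => (x.1, x.2.1, x.2.2 * oneParam j s)

/-- The matrix `-(i/2) σⱼ`. -/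
def gen (j : Fin 3) : Fin 2 → Fin 2 → ℂ := fun a b => -(Complex.I / 2) * pauli j a b

/-- The linear part of the ambient vector field belonging to a direction. -/
def vecLin : Dir → Amb →L[ℝ] Amb
  | .τ => 0
  | .ρ => 0
  | .z j => LinearMap.toContinuousLinearMap
    { toFun := fun y => (0, 0, fun a b => ∑ c, y.2.2 a c * gen j c b)
      map_add' := fun y y' => by
        ext <;> simp [add_mul]; ring
      map_smul' := fun r y => by
        ext <;> simp; ring }

/-- The constant part of the ambient vector field belonging to a direction. -/
def vecConst : Dir → Amb
  | .τ => (1, 0, 0)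
  | .ρ => (0, 1, 0)
  | .z _ => 0

/-- The ambient vector field belonging to a direction. -/
def vec (i : Dir) (y : Amb) : Amb := vecConst i + vecLin i y

theorem hasFDerivAt_vec (i : Dir) (y : Amb) : HasFDerivAt (vec i) (vecLin i) y :=
  (vecLin i).hasFDerivAt.const_add _

theorem contDiff_vec (i : Dir) {n : WithTop ℕ∞} : ContDiff ℝ n (vec i) :=
  contDiff_const.add (vecLin i).contDiff

theorem oneParam_zero (j : Fin 3) : oneParam j 0 = 1 := by
  apply Subtype.ext
  simp [oneParam, oneParamMatrix]

theorem flow_zero (i : Dir) (x : Pt) : flow i x 0 = x := by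
  cases i <;> simp [flow, oneParam_zero]

theorem pd_eq (i : Dir) (f : Field) (x : Pt) : pd i f x = deriv (fun s => f (flow i x s)) 0 := by
  cases i with
  | τ =>
    have := deriv_comp_const_add (fun s => f (s, x.2.1, x.2.2)) x.1 0
    rw [add_zero] at this
    exact this.symm
  | ρ =>
    have := deriv_comp_const_add (fun s => f (x.1, s, x.2.2)) x.2.1 0
    rw [add_zero] at this
    exact this.symm
  | z j => rfl

theorem hasDerivAt_oneParam (j : Fin 3) (a b : Fin 2) :
    HasDerivAt (fun s : ℝ => (oneParam j s).1 a b) (gen j a b) 0 := by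
  have h2 : HasDerivAt (fun s : ℝ => (s : ℂ) / 2) (1 / 2) 0 :=
    (Complex.ofRealCLM.hasDerivAt (x := (0 : ℝ))).div_const 2
  have hc := (Complex.hasDerivAt_cos (((0 : ℝ) : ℂ) / 2)).comp (0 : ℝ) h2
  have hs := (Complex.hasDerivAt_sin (((0 : ℝ) : ℂ) / 2)).comp (0 : ℝ) h2
  have := (hc.mul_const ((1 : Matrix (Fin 2) (Fin 2) ℂ) a b)).sub
    ((hs.const_mul Complex.I).mul_const (pauli j a b))
  refine HasDerivAt.congr_deriv this ?_
  simp only [gen, Complex.ofReal_zero, zero_div, Complex.sin_zero, Complex.cos_zero]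
  ring

theorem continuous_oneParam (j : Fin 3) : Continuous (oneParam j) := by
  refine Continuous.subtype_mk ?_ _
  unfold oneParamMatrix
  fun_prop

theorem continuous_flow (i : Dir) : Continuous fun y : Pt × ℝ => flow i y.1 y.2 := by
  cases i with
  | τ => simp only [flow]; fun_prop
  | ρ => simp only [flow]; fun_prop
  | z j =>
    simp only [flow]
    have := continuous_oneParam j
    fun_prop

theorem continuous_flow_right (i : Dir) (x : Pt) : Continuous (flow i x) :=
  (continuous_flow i).comp (continuous_const.prodMk continuous_id)

theorem hasDerivAt_emb_flow (i : Dir) (x : Pt) :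
    HasDerivAt (fun s => emb (flow i x s)) (vec i (emb x)) 0 := by
  cases i with
  | τ =>
    have h : HasDerivAt (fun s : ℝ => x.1 + s) 1 0 := (hasDerivAt_id (0 : ℝ)).const_add x.1
    have := h.prodMk ((hasDerivAt_const (0 : ℝ) (emb x).2.1).prodMk
      (hasDerivAt_const (0 : ℝ) (emb x).2.2))
    simpa [vec, vecConst, vecLin, emb, flow] using this
  | ρ =>
    have h : HasDerivAt (fun s : ℝ => x.2.1 + s) 1 0 := (hasDerivAt_id (0 : ℝ)).const_add x.2.1
    have := (hasDerivAt_const (0 : ℝ) (emb x).1).prodMk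
      (h.prodMk (hasDerivAt_const (0 : ℝ) (emb x).2.2))
    simpa [vec, vecConst, vecLin, emb, flow] using this
  | z j =>
    have h : HasDerivAt (fun s : ℝ => fun a b => (x.2.2 * oneParam j s).1 a b)
        (fun a b => ∑ c, x.2.2.1 a c * gen j c b) 0 := by
      rw [hasDerivAt_pi]; intro a
      rw [hasDerivAt_pi]; intro b
      simp only [Submonoid.coe_mul, Matrix.mul_apply]
      exact HasDerivAt.fun_sum fun c _ => (hasDerivAt_oneParam j c b).const_mul _
    have := (hasDerivAt_const (0 : ℝ) (emb x).1).prodMk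
      ((hasDerivAt_const (0 : ℝ) (emb x).2.1).prodMk h)
    simpa [vec, vecConst, vecLin, emb, flow] using this

/-- Chain rule along the flow, which stays in the submanifold: any local extension computes the
derivative. Questions about `pd` thus become questions about `fderiv` on a vector space. -/
theorem hasDerivAt_flow_of_eventuallyEq {F : Amb → ℂ} {f : Field} {x : Pt}
    (hF : DifferentiableAt ℝ F (emb x)) (hf : ∀ᶠ y in 𝓝 x, f y = F (emb y)) (i : Dir) :
    HasDerivAt (fun s => f (flow i x s)) (fderiv ℝ F (emb x) (vec i (emb x))) 0 := by
  have h1 : HasDerivAt (fun s => F (emb (flow i x s))) (fderiv ℝ F (emb x) (vec i (emb x))) 0 := by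
    have h := hF.hasFDerivAt
    rw [← flow_zero i x] at h
    have := h.comp_hasDerivAt (0 : ℝ) (by simpa [flow_zero] using hasDerivAt_emb_flow i x)
    simpa [flow_zero, Function.comp_def] using this
  refine h1.congr_of_eventuallyEq ?_
  have hc : Filter.Tendsto (flow i x) (𝓝 0) (𝓝 x) := by
    simpa [flow_zero] using (continuous_flow_right i x).tendsto 0
  exact hc.eventually hf

/-! ### Calculus of functions with local C^k extensions -/

namespace CkAt

variable {k l : ℕ} {f g : Field} {x : Pt}

theorem of_contDiffAt {F : Amb → ℂ} (hF : ContDiffAt ℝ k F (emb x)) :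
    CkAt k (fun y => F (emb y)) x :=
  ⟨F, hF, Filter.Eventually.of_forall fun _ => rfl⟩

theorem of_contDiff {F : ℝ × ℝ → ℂ} (hF : ContDiff ℝ k F) :
    CkAt k (fun y => F (y.1, y.2.1)) x :=
  of_contDiffAt (F := fun y => F (y.1, y.2.1)) (by fun_prop)

theorem const (c : ℂ) : CkAt k (fun _ => c) x := of_contDiff contDiff_const

theorem congr (hf : CkAt k f x) (h : g =ᶠ[𝓝 x] f) : CkAt k g x := by
  obtain ⟨F, hF, hfF⟩ := hf
  exact ⟨F, hF, by filter_upwards [h, hfF] with y h1 h2; rw [h1, h2]⟩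

theorem mono (hf : CkAt k f x) (h : l ≤ k) : CkAt l f x := by
  obtain ⟨F, hF, hfF⟩ := hf
  exact ⟨F, hF.of_le (by exact_mod_cast h), hfF⟩

theorem add (hf : CkAt k f x) (hg : CkAt k g x) : CkAt k (fun y => f y + g y) x := by
  obtain ⟨F, hF, hfF⟩ := hf
  obtain ⟨G, hG, hgG⟩ := hg
  exact ⟨_, hF.add hG, by filter_upwards [hfF, hgG] with y h1 h2; rw [h1, h2]⟩

theorem mul (hf : CkAt k f x) (hg : CkAt k g x) : CkAt k (fun y => f y * g y) x := by
  obtain ⟨F, hF, hfF⟩ := hf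
  obtain ⟨G, hG, hgG⟩ := hg
  exact ⟨_, hF.mul hG, by filter_upwards [hfF, hgG] with y h1 h2; rw [h1, h2]⟩

theorem const_mul (c : ℂ) (hf : CkAt k f x) : CkAt k (fun y => c * f y) x := (const c).mul hf

theorem sub (hf : CkAt k f x) (hg : CkAt k g x) : CkAt k (fun y => f y - g y) x :=
  (hf.add (hg.const_mul (-1))).congr (Filter.Eventually.of_forall fun y =>
    (sub_eq_add_neg _ _).trans (by simp))

theorem neg (hf : CkAt k f x) : CkAt k (fun y => -f y) x :=
  (hf.const_mul (-1)).congr (Filter.Eventually.of_forall fun y => by simp)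

theorem conj (hf : CkAt k f x) : CkAt k (fun y => (starRingEnd ℂ) (f y)) x := by
  obtain ⟨F, hF, hfF⟩ := hf
  refine ⟨fun y => Complex.conjCLE (F y), Complex.conjCLE.contDiff.contDiffAt.comp _ hF, ?_⟩
  filter_upwards [hfF] with y h1
  rw [h1]; rfl

theorem sum {ι : Type*} {s : Finset ι} {f : ι → Field} (hf : ∀ i ∈ s, CkAt k (f i) x) :
    CkAt k (fun y => ∑ i ∈ s, f i y) x := by
  classical
  induction s using Finset.induction_on with
  | empty => simpa using const 0
  | insert a s ha ih =>
    simp only [Finset.sum_insert ha]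
    exact (hf _ (Finset.mem_insert_self _ _)).add (ih fun i hi => hf i (by simp [hi]))

theorem continuousAt (hf : CkAt k f x) : ContinuousAt f x := by
  obtain ⟨F, hF, hfF⟩ := hf
  have : ContinuousAt (fun y => F (emb y)) x :=
    ContinuousAt.comp (f := emb) hF.continuousAt continuous_emb.continuousAt
  exact this.congr (Filter.EventuallyEq.symm hfF)

theorem eventually (hf : CkAt k f x) : ∀ᶠ y in 𝓝 x, CkAt k f y := by
  obtain ⟨F, hF, hfF⟩ := hf
  have h1 : ∀ᶠ y in 𝓝 x, ContDiffAt ℝ k F (emb y) :=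
    continuous_emb.continuousAt.eventually (hF.eventually (by simp))
  filter_upwards [h1, eventually_eventually_nhds.2 hfF] with y h2 h3
  exact ⟨F, h2, h3⟩

theorem hasDerivAt (hf : CkAt 1 f x) (i : Dir) :
    HasDerivAt (fun s => f (flow i x s)) (pd i f x) 0 := by
  obtain ⟨F, hF, hfF⟩ := hf
  have := hasDerivAt_flow_of_eventuallyEq (hF.differentiableAt (by simp)) hfF i
  rw [pd_eq, this.deriv]
  exact this

end CkAt

theorem pd_eventuallyEq_fderiv {F : Amb → ℂ} {f : Field} {x : Pt}
    (hF : ContDiffAt ℝ 1 F (emb x)) (hf : ∀ᶠ y in 𝓝 x, f y = F (emb y)) (i : Dir) :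
    ∀ᶠ y in 𝓝 x, pd i f y = fderiv ℝ F (emb y) (vec i (emb y)) := by
  have h1 : ∀ᶠ y in 𝓝 x, ContDiffAt ℝ 1 F (emb y) :=
    continuous_emb.continuousAt.eventually (hF.eventually (by simp))
  filter_upwards [h1, eventually_eventually_nhds.2 hf] with y h2 h3
  rw [pd_eq, (hasDerivAt_flow_of_eventuallyEq (h2.differentiableAt (by simp)) h3 i).deriv]

theorem CkAt.pd {k : ℕ} {f : Field} {x : Pt} (hf : CkAt (k + 1) f x) (i : Dir) :
    CkAt k (pd i f) x := by
  obtain ⟨F, hF, hfF⟩ := hf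
  refine ⟨fun y => fderiv ℝ F y (vec i y), ?_,
    pd_eventuallyEq_fderiv (hF.of_le (by simp)) hfF i⟩
  exact (hF.fderiv_right (by norm_cast)).clm_apply (contDiff_vec i).contDiffAt

theorem pd_congr {f g : Field} {x : Pt} (h : f =ᶠ[𝓝 x] g) (i : Dir) : pd i f =ᶠ[𝓝 x] pd i g := by
  filter_upwards [eventually_eventually_nhds.2 h] with y hy
  rw [pd_eq, pd_eq]
  apply Filter.EventuallyEq.deriv_eq
  have hc : Filter.Tendsto (flow i y) (𝓝 0) (𝓝 y) := by
    simpa [flow_zero] using (continuous_flow_right i y).tendsto 0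
  exact hc.eventually hy

theorem pd_congr_apply {f g : Field} {x : Pt} (h : f =ᶠ[𝓝 x] g) (i : Dir) :
    pd i f x = pd i g x := (pd_congr h i).eq_of_nhds

section Rules

variable {f g : Field} {x : Pt} (i : Dir)

theorem pd_const (c : ℂ) : pd i (fun _ => c) x = 0 := by
  rw [pd_eq]; simp

theorem pd_add (hf : CkAt 1 f x) (hg : CkAt 1 g x) :
    pd i (fun y => f y + g y) x = pd i f x + pd i g x := by
  rw [pd_eq]; exact ((hf.hasDerivAt i).add (hg.hasDerivAt i)).deriv

theorem pd_mul (hf : CkAt 1 f x) (hg : CkAt 1 g x) :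
    pd i (fun y => f y * g y) x = pd i f x * g x + f x * pd i g x := by
  rw [pd_eq, ((hf.hasDerivAt i).fun_mul (hg.hasDerivAt i)).deriv, flow_zero]

theorem pd_const_mul (c : ℂ) (hf : CkAt 1 f x) : pd i (fun y => c * f y) x = c * pd i f x := by
  rw [pd_mul i (CkAt.const c) hf, pd_const]; ring

theorem pd_sub (hf : CkAt 1 f x) (hg : CkAt 1 g x) :
    pd i (fun y => f y - g y) x = pd i f x - pd i g x := by
  rw [pd_eq]; exact ((hf.hasDerivAt i).sub (hg.hasDerivAt i)).deriv

theorem pd_conj (hf : CkAt 1 f x) :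
    pd i (fun y => (starRingEnd ℂ) (f y)) x = (starRingEnd ℂ) (pd i f x) := by
  rw [pd_eq]; exact (hf.hasDerivAt i).star.deriv

theorem pd_sum {ι : Type*} {s : Finset ι} {f : ι → Field} (hf : ∀ j ∈ s, CkAt 1 (f j) x) :
    pd i (fun y => ∑ j ∈ s, f j y) x = ∑ j ∈ s, pd i (f j) x := by
  rw [pd_eq]; exact (HasDerivAt.fun_sum fun j hj => (hf j hj).hasDerivAt i).deriv

end Rules

/-! ### Commutators of the vector fields -/

/-- The second derivative of the extension is symmetric and cancels, which leaves its first
derivative φ on the Lie bracket of two affine vector fields. All commutation relations are then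
matrix identities. -/
theorem pd_pd_sub_pd_pd {f : Field} {x : Pt} (hf : CkAt 2 f x) : ∃ φ : Amb →ₗ[ℝ] ℂ,
    (∀ i, pd i f x = φ (vec i (emb x))) ∧ ∀ i j, pd i (pd j f) x - pd j (pd i f) x =
      φ (vecLin j (vec i (emb x)) - vecLin i (vec j (emb x))) := by
  obtain ⟨F, hF, hfF⟩ := hf
  refine ⟨(fderiv ℝ F (emb x)).toLinearMap,
    fun i => (pd_eventuallyEq_fderiv (hF.of_le (by norm_cast)) hfF i).self_of_nhds, fun i j => ?_⟩
  have hF' : DifferentiableAt ℝ (fderiv ℝ F) (emb x) :=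
    (hF.fderiv_right (m := 1) (by norm_cast)).differentiableAt (by simp)
  have key : ∀ i j, pd i (pd j f) x = fderiv ℝ (fderiv ℝ F) (emb x) (vec i (emb x)) (vec j (emb x))
      + fderiv ℝ F (emb x) (vecLin j (vec i (emb x))) := by
    intro i j
    have h1 := pd_eventuallyEq_fderiv (hF.of_le (by norm_cast)) hfF j
    have h2 := hF'.hasFDerivAt.clm_apply (hasFDerivAt_vec j (emb x))
    have h3 := hasDerivAt_flow_of_eventuallyEq h2.differentiableAt h1 i
    rw [pd_eq, h3.deriv, h2.fderiv]
    simp [add_comm]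
  have hs : fderiv ℝ (fderiv ℝ F) (emb x) (vec i (emb x)) (vec j (emb x)) =
      fderiv ℝ (fderiv ℝ F) (emb x) (vec j (emb x)) (vec i (emb x)) :=
    hF.isSymmSndFDerivAt (by simp) (vec i (emb x)) (vec j (emb x))
  rw [key, key, hs]
  simp

theorem pd_comm {f : Field} {x : Pt} (hf : CkAt 2 f x) {i : Dir} (hi : i = .τ ∨ i = .ρ) (j : Dir) :
    pd i (pd j f) x = pd j (pd i f) x := by
  obtain ⟨φ, -, h⟩ := pd_pd_sub_pd_pd hf
  rw [← sub_eq_zero, h]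
  rcases hi with rfl | rfl <;> cases j <;> 
    · simp [vecLin, vec, vecConst] <;> exact φ.map_zero

theorem Z_comm {f : Field} {x : Pt} (hf : CkAt 2 f x) :
    Z 0 (Z 1 f) x - Z 1 (Z 0 f) x = Z 2 f x ∧ Z 1 (Z 2 f) x - Z 2 (Z 1 f) x = Z 0 f x ∧
      Z 2 (Z 0 f) x - Z 0 (Z 2 f) x = Z 1 f x := by
  obtain ⟨φ, h0, h⟩ := pd_pd_sub_pd_pd hf
  have e (j) : Z j f x = φ (vec (.z j) (emb x)) := h0 (.z j)
  refine ⟨(h (.z 0) (.z 1)).trans ?_, (h (.z 1) (.z 2)).trans ?_, (h (.z 2) (.z 0)).trans ?_⟩ <;>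
  · rw [e]
    congr 1
    ext a b
    · simp [vec, vecConst, vecLin]
    · simp [vec, vecConst, vecLin]
    · fin_cases b <;> simp [vec, vecConst, vecLin, gen, pauli] <;> grind [Complex.I_sq]

/-! ### Words of derivatives -/

/-- The iterated derivative along a word of directions. -/
def wd (l : List Dir) (f : Field) : Field := l.foldr pd f

theorem wd_nil (f : Field) : wd [] f = f := rfl

theorem wd_cons (i : Dir) (l : List Dir) (f : Field) : wd (i :: l) f = pd i (wd l f) := rfl

theorem wd_append (l l' : List Dir) (f : Field) : wd (l ++ l') f = wd l (wd l' f) :=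
  List.foldr_append

theorem wd_replicate (i : Dir) (k : ℕ) (f : Field) : wd (List.replicate k i) f = (pd i)^[k] f := by
  induction k with
  | zero => rfl
  | succ k ih => rw [List.replicate_succ, wd_cons, ih, Function.iterate_succ_apply']

theorem CkAt.wd {l : List Dir} {k : ℕ} {f : Field} {x : Pt} (hf : CkAt (k + l.length) f x) :
    CkAt k (wd l f) x := by
  induction l generalizing k with
  | nil => exact hf
  | cons i l ih =>
    exact (ih (k := k + 1) (hf.mono (by simp; omega))).pd i

theorem wd_congr {f g : Field} {x : Pt} (h : f =ᶠ[𝓝 x] g) (l : List Dir) :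
    wd l f =ᶠ[𝓝 x] wd l g := by
  induction l with
  | nil => exact h
  | cons i l ih => exact pd_congr ih i

theorem wd_add {l : List Dir} {f g : Field} {x : Pt} (hf : CkAt l.length f x)
    (hg : CkAt l.length g x) : wd l (fun y => f y + g y) x = wd l f x + wd l g x := by
  induction l generalizing x with
  | nil => rfl
  | cons i l ih =>
    have hf' : CkAt (1 + l.length) f x := hf.mono (by simp; omega)
    have hg' : CkAt (1 + l.length) g x := hg.mono (by simp; omega)
    have h : wd l (fun y => f y + g y) =ᶠ[𝓝 x] fun y => wd l f y + wd l g y := by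
      filter_upwards [hf'.eventually, hg'.eventually] with y h1 h2
      exact ih (h1.mono (by omega)) (h2.mono (by omega))
    rw [wd_cons, pd_congr_apply h, pd_add i hf'.wd hg'.wd]; rfl

theorem wd_const_mul {l : List Dir} {f : Field} {x : Pt} (c : ℂ) (hf : CkAt l.length f x) :
    wd l (fun y => c * f y) x = c * wd l f x := by
  induction l generalizing x with
  | nil => rfl
  | cons i l ih =>
    have hf' : CkAt (1 + l.length) f x := hf.mono (by simp; omega)
    have h : wd l (fun y => c * f y) =ᶠ[𝓝 x] fun y => c * wd l f y := by
      filter_upwards [hf'.eventually] with y h1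
      exact ih (h1.mono (by omega))
    rw [wd_cons, pd_congr_apply h, pd_const_mul i c hf'.wd]; rfl

/-- A word of the directions `τ` and `ρ`, which commute with all directions. -/
def Central (c : List Dir) : Prop := ∀ i ∈ c, i = .τ ∨ i = .ρ

theorem wd_pd_comm {c : List Dir} (hc : Central c) {f : Field} {x : Pt}
    (hf : CkAt (c.length + 1) f x) (j : Dir) : wd c (pd j f) x = pd j (wd c f) x := by
  induction c generalizing x with
  | nil => rfl
  | cons i c ih =>
    have hf' : CkAt (2 + c.length) f x := hf.mono (by simp; omega)
    have h : wd c (pd j f) =ᶠ[𝓝 x] pd j (wd c f) := by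
      filter_upwards [hf'.eventually] with y h1
      exact ih (fun i hi => hc i (by simp [hi])) (h1.mono (by omega))
    rw [wd_cons, pd_congr_apply h, pd_comm hf'.wd (hc i (by simp))]; rfl

theorem wd_wd_comm {c : List Dir} (hc : Central c) {l : List Dir} {f : Field} {x : Pt}
    (hf : CkAt (c.length + l.length) f x) : wd c (wd l f) x = wd l (wd c f) x := by
  induction l generalizing x with
  | nil => rfl
  | cons j l ih =>
    have hf' : CkAt ((c.length + 1) + l.length) f x := hf.mono (by simp; omega)
    have h : wd c (wd l f) =ᶠ[𝓝 x] wd l (wd c f) := by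
      filter_upwards [hf'.eventually] with y h1
      exact ih (h1.mono (by omega))
    rw [wd_cons, wd_pd_comm hc hf'.wd, pd_congr_apply h]; rfl

/-! ### The transport operators and the weights of the directions -/

theorem CkAt.coordτ {k : ℕ} {x : Pt} : CkAt k (fun y => (y.1 : ℂ)) x :=
  CkAt.of_contDiff (F := fun y => (y.1 : ℂ)) (Complex.ofRealCLM.contDiff.comp contDiff_fst)

theorem CkAt.coordρ {k : ℕ} {x : Pt} : CkAt k (fun y => (y.2.1 : ℂ)) x :=
  CkAt.of_contDiff (F := fun y => (y.2 : ℂ)) (Complex.ofRealCLM.contDiff.comp contDiff_snd)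

/-- The transport operator `(1 + στ) ∂_τ - σ ρ ∂_ρ`. -/
def transport (σ : ℂ) (f : Field) : Field :=
  fun x => (1 + σ * x.1) * dτ f x - σ * x.2.1 * dρ f x

/-- The weight of a direction with respect to `τ ∂_τ - ρ ∂_ρ`. -/
def wt : Dir → ℂ
  | .τ => 1
  | .ρ => -1
  | .z _ => 0

theorem CkAt.transport {k : ℕ} {f : Field} {x : Pt} (σ : ℂ) (hf : CkAt (k + 1) f x) :
    CkAt k (transport σ f) x :=
  (((CkAt.const 1).add (CkAt.coordτ.const_mul σ)).mul (hf.pd .τ)).sub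
    ((CkAt.coordρ.const_mul σ).mul (hf.pd .ρ))

/-- The operator is ∂_τ, which commutes with every direction, plus σ times the scaling field τ∂_τ −
ρ∂_ρ; each direction is an eigenvector of the bracket with that field. The commutator is therefore
of order zero in `pd i f` and weights add up along words. -/
theorem pd_transport {f : Field} {x : Pt} (σ : ℂ) (hf : CkAt 2 f x) (i : Dir) :
    pd i (transport σ f) x = transport σ (pd i f) x + σ * wt i * pd i f x := by
  have c1 : CkAt 1 (fun y => 1 + σ * y.1) x :=
    (CkAt.const 1).add (CkAt.coordτ.const_mul σ)
  have c2 : CkAt 1 (fun y => σ * y.2.1) x := CkAt.coordρ.const_mul σ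
  have ht : pd i (dτ f) x = dτ (pd i f) x := (pd_comm hf (.inl rfl) i).symm
  have hr : pd i (dρ f) x = dρ (pd i f) x := (pd_comm hf (.inr rfl) i).symm
  have h1 : pd i (fun y => (1 + σ * y.1) * dτ f y - σ * y.2.1 * dρ f y) x = _ :=
    pd_sub i (c1.mul (hf.pd .τ)) (c2.mul (hf.pd .ρ))
  have h2 : pd i (fun y => (1 + σ * y.1) * dτ f y) x = _ := pd_mul i c1 (hf.pd .τ)
  have h3 : pd i (fun y => σ * y.2.1 * dρ f y) x = _ := pd_mul i c2 (hf.pd .ρ)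
  have e : ∀ a : ℝ, HasDerivAt (fun s : ℝ => σ * ((a + s : ℝ) : ℂ)) σ 0 := fun a => by
    have := (((hasDerivAt_id (0 : ℝ)).const_add a).ofReal_comp).const_mul σ
    simpa using this
  have e1 : pd i (fun y => 1 + σ * y.1) x = match i with | .τ => σ | _ => 0 := by
    rw [pd_eq]
    cases i with
    | τ => simpa [flow] using (e x.1).deriv
    | ρ => simp [flow]
    | z j => simp [flow]
  have e2 : pd i (fun y => σ * y.2.1) x = match i with | .ρ => σ | _ => 0 := by
    rw [pd_eq]
    cases i with
    | τ => simp [flow]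
    | ρ => simpa [flow] using (e x.2.1).deriv
    | z j => simp [flow]
  unfold transport
  rw [h1, h2, h3, e1, e2]
  simp only [pd] at ht hr ⊢
  rw [ht, hr]
  cases i <;> simp [wt] <;> ring

theorem wd_transport {l : List Dir} {f : Field} {x : Pt} (σ : ℂ) (hf : CkAt (l.length + 1) f x) :
    wd l (transport σ f) x = transport σ (wd l f) x + σ * (l.map wt).sum * wd l f x := by
  induction l generalizing x with
  | nil => simp [wd_nil]
  | cons i l ih =>
    have hf' : CkAt (2 + l.length) f x := hf.mono (by simp; omega)
    have h : wd l (transport σ f) =ᶠ[𝓝 x]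
        fun y => transport σ (wd l f) y + σ * (l.map wt).sum * wd l f y := by
      filter_upwards [hf'.eventually] with y h1
      exact ih (h1.mono (by omega))
    have hw : CkAt 2 (wd l f) x := hf'.wd
    rw [wd_cons, pd_congr_apply h, pd_add i (hw.transport σ) ((hw.mono (by simp)).const_mul _),
      pd_transport σ hw, pd_const_mul i _ (hw.mono (by simp)), wd_cons, List.map_cons,
      List.sum_cons]
    ring

/-! ### Reordering monomials in Z₁, Z₂, Z₃ -/

/-- The ordered word of the monomial `Z₁^a Z₂^b Z₃^c`. -/
def zw (a : ℕ × ℕ × ℕ) : List Dir :=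
  List.replicate a.1 (.z 0) ++ (List.replicate a.2.1 (.z 1) ++ List.replicate a.2.2 (.z 2))

/-- The total degree of a multi-index. -/
def deg (a : ℕ × ℕ × ℕ) : ℕ := a.1 + a.2.1 + a.2.2

theorem length_zw (a : ℕ × ℕ × ℕ) : (zw a).length = deg a := by
  simp [zw, deg]; ring

/-- The operators that act on functions of class `C^n` as a linear combination of the ordered
monomials of degree at most `n`. -/
inductive OrdSpan (n : ℕ) : (Field → Field) → Prop
  | base (a : ℕ × ℕ × ℕ) (h : deg a ≤ n) : OrdSpan n (wd (zw a))
  | add {T T' : Field → Field} (h : OrdSpan n T) (h' : OrdSpan n T') :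
      OrdSpan n fun f y => T f y + T' f y
  | smul (c : ℂ) {T : Field → Field} (h : OrdSpan n T) : OrdSpan n fun f y => c * T f y
  | congr {T T' : Field → Field} (h : OrdSpan n T)
      (h' : ∀ f x, CkAt n f x → T' f x = T f x) : OrdSpan n T'

namespace OrdSpan

variable {n n' : ℕ} {T T' : Field → Field}

theorem ckAt (h : OrdSpan n T) {k : ℕ} {f : Field} {x : Pt} (hf : CkAt (k + n) f x) :
    CkAt k (T f) x := by
  induction h with
  | base a h => exact CkAt.wd (hf.mono (by rw [length_zw]; omega))
  | add _ _ ih ih' => exact ih.add ih'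
  | smul c _ ih => exact ih.const_mul c
  | congr _ h' ih =>
    refine ih.congr ?_
    filter_upwards [hf.eventually] with y hy
    exact h' f y (hy.mono (by omega))

theorem mono (h : OrdSpan n T) (hn : n ≤ n') : OrdSpan n' T := by
  induction h with
  | base a h => exact base a (h.trans hn)
  | add _ _ ih ih' => exact add ih ih'
  | smul c _ ih => exact smul c ih
  | congr _ h' ih => exact congr ih fun f x hf => h' f x (hf.mono hn)

/-- Linearity reduces the composition to ordered monomials. Since `CkAt` is an open condition,
identities between operators hold near the point and may be differentiated. -/
theorem pd_comp_of_base {j : Dir}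
    (hb : ∀ a, deg a ≤ n → OrdSpan (n + 1) fun f => pd j (wd (zw a) f)) (h : OrdSpan n T) :
    OrdSpan (n + 1) fun f => pd j (T f) := by
  induction h with
  | base a h => exact hb a h
  | add h h' ih ih' =>
    refine congr (add ih ih') fun f x hf => pd_add j (h.ckAt ?_) (h'.ckAt ?_) <;>
    exact hf.mono (by omega)
  | smul c h ih =>
    exact congr (smul c ih) fun f x hf => pd_const_mul j c (h.ckAt (hf.mono (by omega)))
  | congr h h' ih =>
    refine congr ih fun f x hf => pd_congr_apply ?_ j
    filter_upwards [hf.eventually] with y hy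
    exact h' f y (hy.mono (by omega))

theorem pd_zero (h : OrdSpan n T) : OrdSpan (n + 1) fun f => pd (.z 0) (T f) :=
  h.pd_comp_of_base fun a ha => base (a.1 + 1, a.2) (by simp only [deg] at *; omega)

theorem sub (h : OrdSpan n T) (h' : OrdSpan n T') : OrdSpan n fun f y => T f y - T' f y :=
  congr (add h (smul (-1) h')) fun f x _ => by ring

/-- The Poincaré–Birkhoff–Witt reordering: Z_j is moved to the right past a smaller Z_i, and the
bracket left behind is again a single field on a shorter monomial, covered by the induction
hypothesis. -/
theorem pd_base (n : ℕ) : ∀ j a, deg a ≤ n → OrdSpan (n + 1) fun f => pd (.z j) (wd (zw a) f) := by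
  induction n with
  | zero =>
    intro j a ha
    obtain rfl : a = (0, 0, 0) := by
      obtain ⟨a, b, c⟩ := a
      simp only [deg] at ha
      simp; omega
    fin_cases j
    · exact base (1, 0, 0) le_rfl
    · exact base (0, 1, 0) le_rfl
    · exact base (0, 0, 1) le_rfl
  | succ n ih =>
    have h0 : ∀ a, deg a ≤ n + 1 → OrdSpan (n + 2) fun f => pd (.z 0) (wd (zw a) f) :=
      fun a ha => (base a ha).pd_zero
    have hC : ∀ {a : ℕ × ℕ × ℕ} {f : Field} {x : Pt}, deg a ≤ n → CkAt (n + 2) f x →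
        CkAt 2 (wd (zw a) f) x := fun ha hf => CkAt.wd (hf.mono (by rw [length_zw]; omega))
    have h1 : ∀ a, deg a ≤ n + 1 → OrdSpan (n + 2) fun f => pd (.z 1) (wd (zw a) f) := by
      rintro ⟨a, b, c⟩ ha
      cases a with
      | zero => exact base (0, b + 1, c) (by simp only [deg] at *; omega)
      | succ a =>
        have hd : deg (a, b, c) ≤ n := by simp only [deg] at *; omega
        refine congr (sub (pd_zero (ih 1 (a, b, c) hd)) ((ih 2 (a, b, c) hd).mono (by omega)))
          fun f x hf => ?_
        change Z 1 (Z 0 (wd (zw (a, b, c)) f)) x = Z 0 (Z 1 (wd (zw (a, b, c)) f)) x -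
          Z 2 (wd (zw (a, b, c)) f) x
        linear_combination -(Z_comm (hC hd hf)).1
    have h2 : ∀ a, deg a ≤ n + 1 → OrdSpan (n + 2) fun f => pd (.z 2) (wd (zw a) f) := by
      rintro ⟨a, b, c⟩ ha
      cases a with
      | zero =>
        cases b with
        | zero => exact base (0, 0, c + 1) (by simp only [deg] at *; omega)
        | succ b =>
          have hd : deg (0, b, c) ≤ n := by simp only [deg] at *; omega
          -- Z₂ now acts on a combination of monomials of degree up to n + 1, beyond the induction
          -- hypothesis; `h1`, just proved at this degree, covers it.
          refine congr (sub (pd_comp_of_base h1 (ih 2 (0, b, c) hd))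
            ((ih 0 (0, b, c) hd).mono (by omega))) fun f x hf => ?_
          change Z 2 (Z 1 (wd (zw (0, b, c)) f)) x = Z 1 (Z 2 (wd (zw (0, b, c)) f)) x -
            Z 0 (wd (zw (0, b, c)) f) x
          linear_combination -(Z_comm (hC hd hf)).2.1
      | succ a =>
        have hd : deg (a, b, c) ≤ n := by simp only [deg] at *; omega
        refine congr (add (pd_zero (ih 2 (a, b, c) hd)) ((ih 1 (a, b, c) hd).mono (by omega)))
          fun f x hf => ?_
        change Z 2 (Z 0 (wd (zw (a, b, c)) f)) x = Z 0 (Z 2 (wd (zw (a, b, c)) f)) x +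
          Z 1 (wd (zw (a, b, c)) f) x
        linear_combination (Z_comm (hC hd hf)).2.2
    intro j
    fin_cases j
    exacts [h0, h1, h2]

theorem pd_comp (h : OrdSpan n T) (j : Fin 3) : OrdSpan (n + 1) fun f => pd (.z j) (T f) :=
  h.pd_comp_of_base (pd_base n j)

theorem word (l : List (Fin 3)) : OrdSpan l.length (wd (l.map .z)) := by
  induction l with
  | nil => exact base (0, 0, 0) le_rfl
  | cons i l ih => exact ih.pd_comp i

end OrdSpan

theorem exists_Z_comm (i j : Fin 3) : ∃ (c : ℂ) (k : Fin 3), ∀ f x, CkAt 2 f x →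
    Z i (Z j f) x - Z j (Z i f) x = c * Z k f x := by
  match i, j with
  | 0, 0 => exact ⟨0, 0, fun f x _ => by simp⟩
  | 0, 1 => exact ⟨1, 2, fun f x hf => by linear_combination (Z_comm hf).1⟩
  | 0, 2 => exact ⟨-1, 1, fun f x hf => by linear_combination -(Z_comm hf).2.2⟩
  | 1, 0 => exact ⟨-1, 2, fun f x hf => by linear_combination -(Z_comm hf).1⟩
  | 1, 1 => exact ⟨0, 0, fun f x _ => by simp⟩
  | 1, 2 => exact ⟨1, 0, fun f x hf => by linear_combination (Z_comm hf).2.1⟩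
  | 2, 0 => exact ⟨1, 1, fun f x hf => by linear_combination (Z_comm hf).2.2⟩
  | 2, 1 => exact ⟨-1, 0, fun f x hf => by linear_combination -(Z_comm hf).2.1⟩
  | 2, 2 => exact ⟨0, 0, fun f x _ => by simp⟩

/-- The point is the order: a commutator with Z_j has order `l.length`, one less than either
product. It follows from Leibniz, as each [Z_i, Z_j] is a multiple of one Z_k. -/
theorem OrdSpan.commutator (l : List (Fin 3)) (j : Fin 3) : ∃ T, OrdSpan l.length T ∧
    ∀ f x, CkAt (l.length + 1) f x →
      wd (l.map .z) (Z j f) x - Z j (wd (l.map .z) f) x = T f x := by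
  induction l with
  | nil => exact ⟨fun f y => 0 * wd (zw 0) f y, .smul 0 (.base 0 le_rfl),
      fun f x _ => by simp [wd_nil]⟩
  | cons i l ih =>
    obtain ⟨T, hT, h⟩ := ih
    obtain ⟨c, k, hc⟩ := exists_Z_comm i j
    refine ⟨_, (hT.pd_comp i).add (((OrdSpan.word l).pd_comp k).smul c), fun f x hf => ?_⟩
    have hf' : CkAt (2 + (l.map Dir.z).length) f x := hf.mono (by simp; omega)
    have h1 : T f =ᶠ[𝓝 x] fun y => wd (l.map .z) (Z j f) y - Z j (wd (l.map .z) f) y := by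
      filter_upwards [hf.eventually] with y hy
      exact (h f y (hy.mono (by simp))).symm
    have hw : CkAt 2 (wd (l.map .z) f) x := hf'.wd
    have hj : CkAt (1 + (l.map Dir.z).length) (Z j f) x :=
      (hf'.mono (l := 1 + (l.map Dir.z).length + 1) (by omega)).pd (.z j)
    have h2 := pd_sub (.z i) hj.wd (hw.pd (.z j))
    rw [pd_congr_apply h1]
    have h3 := hc _ x hw
    rw [List.map_cons, wd_cons, wd_cons]
    simp only [pd] at h2 h3 ⊢
    rw [h2, ← h3]
    ring

/-- The multi-indices of total degree at most `n`. -/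
def multi (n : ℕ) : Finset (ℕ × ℕ × ℕ) :=
  (Finset.range (n + 1) ×ˢ Finset.range (n + 1) ×ˢ Finset.range (n + 1)).filter fun a => deg a ≤ n

theorem mem_multi {n : ℕ} {a : ℕ × ℕ × ℕ} : a ∈ multi n ↔ deg a ≤ n := by
  rw [multi, Finset.mem_filter]
  simp only [deg, Finset.mem_product, Finset.mem_range]
  omega

theorem OrdSpan.exists_bound {n : ℕ} {T : Field → Field} (h : OrdSpan n T) : ∃ C : ℝ, 0 ≤ C ∧
    ∀ f x, CkAt n f x → ‖T f x‖ ≤ C * ∑ a ∈ multi n, ‖wd (zw a) f x‖ := by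
  induction h with
  | base a h =>
    refine ⟨1, zero_le_one, fun f x _ => ?_⟩
    rw [one_mul]
    exact Finset.single_le_sum (f := fun a => ‖wd (zw a) f x‖) (fun _ _ => norm_nonneg _)
      (mem_multi.2 h)
  | add _ _ ih ih' =>
    obtain ⟨C, hC, h⟩ := ih
    obtain ⟨C', hC', h'⟩ := ih'
    refine ⟨C + C', by positivity, fun f x hf => (norm_add_le _ _).trans ?_⟩
    rw [add_mul]
    exact add_le_add (h f x hf) (h' f x hf)
  | smul c _ ih =>
    obtain ⟨C, hC, h⟩ := ih
    refine ⟨‖c‖ * C, by positivity, fun f x hf => ?_⟩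
    rw [norm_mul, mul_assoc]
    exact mul_le_mul_of_nonneg_left (h f x hf) (norm_nonneg _)
  | congr _ h' ih =>
    obtain ⟨C, hC, h⟩ := ih
    exact ⟨C, hC, fun f x hf => by rw [h' f x hf]; exact h f x hf⟩

/-! ### The commuted operators and their commutators with Z_j -/

/-- The operators `D n ∘ ∂_ρ^p`. -/
def W (p : ℕ) (n : ℕ × ℕ × ℕ × ℕ × ℕ) (f : Field) : Field := D n (dρ^[p] f)

/-- The part of the word of `D n` in the directions `ρ` and `τ`. -/
def centralWord (n : ℕ × ℕ × ℕ × ℕ × ℕ) : List Dir :=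
  List.replicate n.1 .ρ ++ List.replicate n.2.1 .τ

theorem central_centralWord (n : ℕ × ℕ × ℕ × ℕ × ℕ) : Central (centralWord n) := by
  intro i hi
  rcases List.mem_append.1 hi with h | h
  · exact .inr (List.eq_of_mem_replicate h)
  · exact .inl (List.eq_of_mem_replicate h)

theorem central_replicate (p : ℕ) : Central (List.replicate p .ρ) := fun _ hi =>
  .inr (List.eq_of_mem_replicate hi)

theorem W_eq (p : ℕ) (n : ℕ × ℕ × ℕ × ℕ × ℕ) (f : Field) :
    W p n f = wd (centralWord n) (wd (zw n.2.2) (wd (List.replicate p .ρ) f)) := by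
  simp only [W, D, centralWord, zw, wd_append, wd_replicate]
  rfl

theorem W_eq_wd (p : ℕ) (n : ℕ × ℕ × ℕ × ℕ × ℕ) (f : Field) :
    W p n f = wd (centralWord n ++ (zw n.2.2 ++ List.replicate p .ρ)) f := by
  rw [W_eq, wd_append, wd_append]

theorem length_centralWord (n : ℕ × ℕ × ℕ × ℕ × ℕ) : (centralWord n).length = n.1 + n.2.1 := by
  simp [centralWord]

theorem mem_indices_iff {m : ℕ} {n : ℕ × ℕ × ℕ × ℕ × ℕ} :
    n ∈ indices m ↔ n.1 + n.2.1 + deg n.2.2 ≤ m := mem_indices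

theorem length_word_le {m p : ℕ} {n : ℕ × ℕ × ℕ × ℕ × ℕ} (hn : n ∈ indices m) :
    (centralWord n ++ (zw n.2.2 ++ List.replicate p Dir.ρ)).length ≤ p + m := by
  have := mem_indices_iff.1 hn
  simp only [List.length_append, length_centralWord, length_zw, List.length_replicate]
  omega

section Operators

variable {p m : ℕ} {n : ℕ × ℕ × ℕ × ℕ × ℕ} {f g : Field} {x : Pt}

theorem CkAt.W {k : ℕ} (hn : n ∈ indices m) (hf : CkAt (p + m + k) f x) : CkAt k (W p n f) x := by
  rw [W_eq_wd]
  exact CkAt.wd (hf.mono (by have := length_word_le (p := p) hn; omega))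

theorem W_congr (h : f =ᶠ[𝓝 x] g) : W p n f x = W p n g x := by
  rw [W_eq_wd, W_eq_wd]
  exact (wd_congr h _).self_of_nhds

theorem W_add (hn : n ∈ indices m) (hf : CkAt (p + m) f x) (hg : CkAt (p + m) g x) :
    W p n (fun y => f y + g y) x = W p n f x + W p n g x := by
  simp only [W_eq_wd]
  exact wd_add (hf.mono (length_word_le hn)) (hg.mono (length_word_le hn))

theorem W_const_mul (hn : n ∈ indices m) (c : ℂ) (hf : CkAt (p + m) f x) :
    W p n (fun y => c * f y) x = c * W p n f x := by
  simp only [W_eq_wd]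
  exact wd_const_mul c (hf.mono (length_word_le hn))

theorem W_transport (hn : n ∈ indices m) (σ : ℂ) (hf : CkAt (p + m + 1) f x) :
    W p n (transport σ f) x = transport σ (W p n f) x + σ * (n.2.1 - n.1 - p) * W p n f x := by
  simp only [W_eq_wd]
  rw [wd_transport σ (hf.mono (by have := length_word_le (p := p) hn; omega))]
  congr 3
  simp [centralWord, zw, wt]
  ring

end Operators

/-- The ρ and τ derivatives commute with Z_j, so only Z^α contributes. Its commutator produces Z^β
with |β| ≤ |α| and the same p', q', hence terms of the same energy. The constant does not depend on
p. -/
theorem exists_bound_W_Z_comm (m : ℕ) : ∃ C : ℝ, 0 ≤ C ∧ ∀ (p : ℕ), ∀ n ∈ indices m, ∀ j f x,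
    CkAt (p + m + 1) f x →
      ‖W p n (Z j f) x - Z j (W p n f) x‖ ≤ C * ∑ n' ∈ indices m, ‖W p n' f x‖ := by
  have key : ∀ (a : ℕ × ℕ × ℕ) (j : Fin 3), ∃ C : ℝ, 0 ≤ C ∧ ∀ f x, CkAt (deg a + 1) f x →
      ‖wd (zw a) (Z j f) x - Z j (wd (zw a) f) x‖ ≤ C * ∑ b ∈ multi (deg a), ‖wd (zw b) f x‖ := by
    intro a j
    let l : List (Fin 3) :=
      List.replicate a.1 0 ++ (List.replicate a.2.1 1 ++ List.replicate a.2.2 2)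
    have hl : l.map Dir.z = zw a := by simp [l, zw]
    have hd : l.length = deg a := by rw [← length_zw, ← hl, List.length_map]
    obtain ⟨T, hT, h⟩ := OrdSpan.commutator l j
    obtain ⟨C, hC, h'⟩ := hT.exists_bound
    rw [hl, hd] at h
    rw [hd] at h'
    exact ⟨C, hC, fun f x hf => by rw [h f x hf]; exact h' f x (hf.mono (by omega))⟩
  choose C hC hb using key
  refine ⟨∑ n ∈ indices m, ∑ j, C n.2.2 j, Finset.sum_nonneg fun n _ => Finset.sum_nonneg
    fun j _ => hC _ _, fun p n hn j f x hf => ?_⟩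
  have hdeg := mem_indices_iff.1 hn
  have hlen := length_centralWord n
  have hz := length_zw n.2.2
  have hr : (List.replicate p Dir.ρ).length = p := List.length_replicate
  set r := wd (List.replicate p Dir.ρ) f with hr_def
  have hCr : CkAt (m + 1) r x := CkAt.wd (hf.mono (by omega))
  set f' := wd (centralWord n) r with hf'_def
  have hCf' : CkAt (deg n.2.2 + 1) f' x := CkAt.wd (hCr.mono (by omega))
  have hZ : CkAt m (Z j r) x := hCr.pd (.z j)
  -- The central derivatives are moved innermost, onto f' = ∂_ρ^{p'} ∂_τ^{q'} ∂_ρ^p f, where the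
  -- bound for pure Z-monomials applies.
  have e1 : W p n (Z j f) x = wd (zw n.2.2) (Z j f') x := by
    rw [W_eq]
    have h1 : wd (List.replicate p Dir.ρ) (Z j f) =ᶠ[𝓝 x] Z j r := by
      filter_upwards [hf.eventually] with y hy
      exact wd_pd_comm (central_replicate p) (hy.mono (by omega)) (.z j)
    rw [(wd_congr (wd_congr h1 _) _).self_of_nhds,
      wd_wd_comm (l := zw n.2.2) (central_centralWord n) (hZ.mono (by omega))]
    refine (wd_congr ?_ _).self_of_nhds
    filter_upwards [hCr.eventually] with y hy
    exact wd_pd_comm (central_centralWord n) (hy.mono (by omega)) (.z j)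
  have e2 : ∀ b, n.1 + n.2.1 + deg b ≤ m → W p (n.1, n.2.1, b) f =ᶠ[𝓝 x] wd (zw b) f' := by
    intro b hb
    filter_upwards [hCr.eventually] with y hy
    rw [W_eq]
    change wd (centralWord n) (wd (zw b) r) y = _
    exact wd_wd_comm (central_centralWord n) (hy.mono (by rw [length_zw]; omega))
  have e3 : Z j (W p n f) x = Z j (wd (zw n.2.2) f') x :=
    pd_congr_apply (e2 n.2.2 hdeg) (.z j)
  rw [e1, e3]
  refine (hb n.2.2 j f' x hCf').trans ?_
  refine mul_le_mul ?_ ?_ (Finset.sum_nonneg fun _ _ => norm_nonneg _) (Finset.sum_nonneg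
    fun n _ => Finset.sum_nonneg fun j _ => hC _ _)
  · refine (Finset.single_le_sum (f := fun j => C n.2.2 j) (fun j _ => hC _ j)
      (Finset.mem_univ j)).trans ?_
    exact Finset.single_le_sum (f := fun n : ℕ × ℕ × ℕ × ℕ × ℕ => ∑ j, C n.2.2 j)
      (fun n _ => Finset.sum_nonneg fun j _ => hC _ j) hn
  · calc ∑ b ∈ multi (deg n.2.2), ‖wd (zw b) f' x‖
        = ∑ b ∈ multi (deg n.2.2), ‖W p (n.1, n.2.1, b) f x‖ := by
          refine Finset.sum_congr rfl fun b hb => ?_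
          rw [(e2 b (by have := mem_multi.1 hb; omega)).self_of_nhds]
      _ = ∑ n' ∈ (multi (deg n.2.2)).image (fun b => (n.1, n.2.1, b)), ‖W p n' f x‖ := by
          rw [Finset.sum_image]
          intro b _ b' _ h
          simpa using h
      _ ≤ _ := by
          refine Finset.sum_le_sum_of_subset_of_nonneg ?_ fun _ _ _ => norm_nonneg _
          intro n' hn'
          obtain ⟨b, hb, rfl⟩ := Finset.mem_image.1 hn'
          have := mem_multi.1 hb
          exact mem_indices_iff.2 (by simp only; omega)

/-! ### Product and conjugation rules for the transport operators and X± -/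

/-- The operator `-(Z₂ + c Z₁)`. -/
def Xop (c : ℂ) (f : Field) : Field := fun x => -(Z 1 f x + c * Z 0 f x)

theorem Xplus_eq (f : Field) : Xplus f = Xop Complex.I f := rfl

theorem Xminus_eq (f : Field) : Xminus f = Xop (-Complex.I) f := by
  funext x; simp only [Xminus, Xop]; ring

section Derivations

variable {f g : Field} {x : Pt}

theorem CkAt.xop {k : ℕ} (c : ℂ) (hf : CkAt (k + 1) f x) : CkAt k (Xop c f) x :=
  ((hf.pd (.z 1)).add ((hf.pd (.z 0)).const_mul c)).neg

theorem transport_congr (h : f =ᶠ[𝓝 x] g) (σ : ℂ) : transport σ f x = transport σ g x := by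
  have h1 := pd_congr_apply h .τ
  have h2 := pd_congr_apply h .ρ
  simp only [pd] at h1 h2
  simp only [transport, h1, h2]

theorem Xop_congr (h : f =ᶠ[𝓝 x] g) (c : ℂ) : Xop c f x = Xop c g x := by
  have h1 := pd_congr_apply h (.z 0)
  have h2 := pd_congr_apply h (.z 1)
  simp only [pd] at h1 h2
  simp only [Xop, h1, h2]

theorem transport_mul (σ : ℂ) (hf : CkAt 1 f x) (hg : CkAt 1 g x) :
    transport σ (fun y => f y * g y) x = transport σ f x * g x + f x * transport σ g x := by
  have h1 := pd_mul .τ hf hg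
  have h2 := pd_mul .ρ hf hg
  simp only [pd] at h1 h2
  simp only [transport, h1, h2]
  ring

theorem transport_conj (σ : ℝ) (hf : CkAt 1 f x) :
    transport σ (fun y => (starRingEnd ℂ) (f y)) x = (starRingEnd ℂ) (transport σ f x) := by
  have h1 := pd_conj .τ hf
  have h2 := pd_conj .ρ hf
  simp only [pd] at h1 h2
  simp [transport, h1, h2]

theorem transport_sum {ι : Type*} {s : Finset ι} {f : ι → Field} (σ : ℂ)
    (hf : ∀ j ∈ s, CkAt 1 (f j) x) :
    transport σ (fun y => ∑ j ∈ s, f j y) x = ∑ j ∈ s, transport σ (f j) x := by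
  have h1 := pd_sum .τ hf
  have h2 := pd_sum .ρ hf
  simp only [pd] at h1 h2
  simp only [transport, h1, h2, Finset.mul_sum, Finset.sum_sub_distrib]

theorem transport_normSq (σ : ℝ) (hf : CkAt 1 f x) :
    (transport σ (fun y => f y * (starRingEnd ℂ) (f y)) x).re =
      2 * ((starRingEnd ℂ) (f x) * transport σ f x).re := by
  rw [transport_mul _ hf hf.conj, transport_conj _ hf]
  simp [Complex.mul_re]
  ring

theorem Xop_mul (c : ℂ) (hf : CkAt 1 f x) (hg : CkAt 1 g x) :
    Xop c (fun y => f y * g y) x = Xop c f x * g x + f x * Xop c g x := by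
  have h1 := pd_mul (.z 0) hf hg
  have h2 := pd_mul (.z 1) hf hg
  simp only [pd] at h1 h2
  simp only [Xop, h1, h2]
  ring

theorem Xop_sum {ι : Type*} {s : Finset ι} {f : ι → Field} (c : ℂ)
    (hf : ∀ j ∈ s, CkAt 1 (f j) x) :
    Xop c (fun y => ∑ j ∈ s, f j y) x = ∑ j ∈ s, Xop c (f j) x := by
  have h1 := pd_sum (.z 0) hf
  have h2 := pd_sum (.z 1) hf
  simp only [pd] at h1 h2
  simp only [Xop, h1, h2, Finset.mul_sum, Finset.sum_add_distrib, Finset.sum_neg_distrib]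

theorem Xop_conj (c : ℂ) (hf : CkAt 1 f x) :
    Xop c (fun y => (starRingEnd ℂ) (f y)) x = (starRingEnd ℂ) (Xop ((starRingEnd ℂ) c) f x) := by
  have h1 := pd_conj (.z 0) hf
  have h2 := pd_conj (.z 1) hf
  simp only [pd] at h1 h2
  simp [Xop, h1, h2]

/-- X₊ḡ is the conjugate of X₋g. This makes the coupling of each pair symmetric: the cross terms in
the energy identity are an exact derivative. -/
theorem Xplus_mul_conj (hf : CkAt 1 f x) (hg : CkAt 1 g x) :
    (Xplus (fun y => f y * (starRingEnd ℂ) (g y)) x).re =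
      ((starRingEnd ℂ) (f x) * Xminus g x).re + ((starRingEnd ℂ) (g x) * Xplus f x).re := by
  rw [Xplus_eq, Xplus_eq, Xminus_eq, Xop_mul _ hf hg.conj, Xop_conj _ hg]
  simp [Complex.mul_re]
  ring

theorem W_Xop {p m : ℕ} {n : ℕ × ℕ × ℕ × ℕ × ℕ} (hn : n ∈ indices m) (c : ℂ)
    (hf : CkAt (p + m + 1) f x) :
    W p n (Xop c f) x = -(W p n (Z 1 f) x + c * W p n (Z 0 f) x) := by
  have h1 : CkAt (p + m) (Z 1 f) x := hf.pd (.z 1)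
  have h0 : CkAt (p + m) (Z 0 f) x := hf.pd (.z 0)
  have e : Xop c f = fun y => (-1) * (Z 1 f y + c * Z 0 f y) := by funext y; simp [Xop]
  rw [e, W_const_mul hn _ (h1.add (h0.const_mul c)), W_add hn h1 (h0.const_mul c),
    W_const_mul hn c h0]
  ring

end Derivations

theorem exists_bound_W_Xop_comm (m : ℕ) : ∃ C : ℝ, 0 ≤ C ∧ ∀ (p : ℕ), ∀ n ∈ indices m,
    ∀ c : ℂ, ‖c‖ ≤ 1 → ∀ f x, CkAt (p + m + 1) f x →
      ‖W p n (Xop c f) x - Xop c (W p n f) x‖ ^ 2 ≤ C * ∑ n' ∈ indices m, ‖W p n' f x‖ ^ 2 := by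
  obtain ⟨C, hC, h⟩ := exists_bound_W_Z_comm m
  refine ⟨(2 * C) ^ 2 * (indices m).card, by positivity, fun p n hn c hc f x hf => ?_⟩
  set s := ∑ n' ∈ indices m, ‖W p n' f x‖ with hs
  have h1 := h p n hn 1 f x hf
  have h0 := h p n hn 0 f x hf
  have hb : ‖W p n (Xop c f) x - Xop c (W p n f) x‖ ≤ 2 * C * s := by
    have e : W p n (Xop c f) x - Xop c (W p n f) x =
        -((W p n (Z 1 f) x - Z 1 (W p n f) x) + c * (W p n (Z 0 f) x - Z 0 (W p n f) x)) := by
      rw [W_Xop hn c hf]; simp only [Xop]; ring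
    rw [e, norm_neg]
    refine (norm_add_le _ _).trans ?_
    rw [norm_mul]
    have := mul_le_of_le_one_left (norm_nonneg (W p n (Z 0 f) x - Z 0 (W p n f) x)) hc
    linarith
  calc _ ≤ (2 * C * s) ^ 2 := by gcongr
    _ = (2 * C) ^ 2 * s ^ 2 := by ring
    _ ≤ (2 * C) ^ 2 * ((indices m).card * ∑ n' ∈ indices m, ‖W p n' f x‖ ^ 2) := by
      gcongr
      exact sq_sum_le_card_mul_sum_sq
    _ = _ := by ring

/-! ### The pointwise energy inequality -/

/-- The sum of the squares of the derivatives `W p n f`, as a complex field. -/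
def energy (p m : ℕ) (f : Field) : Field :=
  fun y => ∑ n ∈ indices m, W p n f y * (starRingEnd ℂ) (W p n f y)

/-- The mixed sum of the products of the derivatives `W p n f` and `W p n g`. -/
def cross (p m : ℕ) (f g : Field) : Field :=
  fun y => ∑ n ∈ indices m, W p n f y * (starRingEnd ℂ) (W p n g y)

theorem energy_eq (p m : ℕ) (f : Field) (x : Pt) :
    energy p m f x = ((∑ n ∈ indices m, ‖W p n f x‖ ^ 2 : ℝ) : ℂ) := by
  simp [energy, Complex.mul_conj, Complex.normSq_eq_norm_sq]

theorem two_mul_re_le (a b : ℂ) {k : ℝ} (hk : 0 < k) :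
    2 * ((starRingEnd ℂ) a * b).re ≤ k * ‖a‖ ^ 2 + k⁻¹ * ‖b‖ ^ 2 := by
  have h1 : ((starRingEnd ℂ) a * b).re ≤ ‖a‖ * ‖b‖ := by
    refine (Complex.re_le_norm _).trans ?_
    simp
  have h2 : k * k⁻¹ = 1 := mul_inv_cancel₀ hk.ne'
  have h3 : 0 ≤ k⁻¹ * (k * ‖a‖ - ‖b‖) ^ 2 := by positivity
  have h4 : k⁻¹ * (k * ‖a‖ - ‖b‖) ^ 2 = k * ‖a‖ ^ 2 - 2 * (‖a‖ * ‖b‖) + k⁻¹ * ‖b‖ ^ 2 := by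
    field_simp
    ring
  linarith

/-- The sign of the `energy p m v` term is the crux. The coefficient of |V|² is −2(p+p'−q'−c₂) ≤ −2,
because p ≥ m+2, q' ≤ m and c₂ ≤ 1; the commutator terms consume at most half of this. Everything in
u may be large. -/
theorem exists_energy_inequality (p m : ℕ) (hpm : m + 1 < p) : ∃ C : ℝ, 0 ≤ C ∧
    ∀ c₁ c₂ : ℝ, c₁ ≤ 0 → c₂ ≤ 1 → ∀ (u v : Field) (x : Pt),
      CkAt (p + m + 1) u x → CkAt (p + m + 1) v x →
      (∀ᶠ y in 𝓝 x, transport 1 u y = c₁ * u y + Xminus v y) →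
      (∀ᶠ y in 𝓝 x, transport (-1) v y = c₂ * v y + Xplus u y) →
      (transport 1 (energy p m u) x).re + (transport (-1) (energy p m v) x).re ≤
        C * (energy p m u x).re - (energy p m v x).re + 2 * (Xplus (cross p m u v) x).re := by
  obtain ⟨Q, hQ, hcomm⟩ := exists_bound_W_Xop_comm m
  set N : ℝ := ((indices m).card : ℝ) with hN
  have hN0 : 0 ≤ N := Nat.cast_nonneg _
  -- R is bounded by the energy of v, so the Young parameter k must be large: summed over the N
  -- indices, k⁻¹|R|² costs at most NQk⁻¹B ≤ B/2, at the price of kA.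
  set k : ℝ := 2 * (Q * N + 1) with hk
  have hk0 : 0 < k := by positivity
  refine ⟨2 * (p + m) + k + 2 * N * Q, by positivity, fun c₁ c₂ hc₁ hc₂ u v x hu hv eu ev => ?_⟩
  have hU : ∀ n ∈ indices m, CkAt 1 (W p n u) x := fun n hn => CkAt.W hn hu
  have hV : ∀ n ∈ indices m, CkAt 1 (W p n v) x := fun n hn => CkAt.W hn hv
  have hA : (energy p m u x).re = ∑ n ∈ indices m, ‖W p n u x‖ ^ 2 := by
    rw [energy_eq, Complex.ofReal_re]
  have hB : (energy p m v x).re = ∑ n ∈ indices m, ‖W p n v x‖ ^ 2 := by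
    rw [energy_eq, Complex.ofReal_re]
  set A := (energy p m u x).re
  set B := (energy p m v x).re
  have hA0 : 0 ≤ A := hA ▸ Finset.sum_nonneg fun _ _ => by positivity
  have hB0 : 0 ≤ B := hB ▸ Finset.sum_nonneg fun _ _ => by positivity
  have tA : (transport 1 (energy p m u) x).re =
      ∑ n ∈ indices m, 2 * ((starRingEnd ℂ) (W p n u x) * transport 1 (W p n u) x).re := by
    have : transport 1 (energy p m u) x = _ := transport_sum (x := x) 1 (s := indices m)
      (f := fun n y => W p n u y * (starRingEnd ℂ) (W p n u y))
      fun n hn => (hU n hn).mul (hU n hn).conj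
    rw [this, Complex.re_sum]
    refine Finset.sum_congr rfl fun n hn => ?_
    simpa using transport_normSq 1 (hU n hn)
  have tB : (transport (-1) (energy p m v) x).re =
      ∑ n ∈ indices m, 2 * ((starRingEnd ℂ) (W p n v x) * transport (-1) (W p n v) x).re := by
    have : transport (-1) (energy p m v) x = _ := transport_sum (x := x) (-1) (s := indices m)
      (f := fun n y => W p n v y * (starRingEnd ℂ) (W p n v y))
      fun n hn => (hV n hn).mul (hV n hn).conj
    rw [this, Complex.re_sum]
    refine Finset.sum_congr rfl fun n hn => ?_
    simpa using transport_normSq (-1) (hV n hn)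
  have tS : (Xplus (cross p m u v) x).re = ∑ n ∈ indices m,
      (((starRingEnd ℂ) (W p n u x) * Xminus (W p n v) x).re +
        ((starRingEnd ℂ) (W p n v x) * Xplus (W p n u) x).re) := by
    have : Xplus (cross p m u v) x = _ := Xop_sum (x := x) Complex.I (s := indices m)
      (f := fun n y => W p n u y * (starRingEnd ℂ) (W p n v y))
      fun n hn => (hU n hn).mul (hV n hn).conj
    rw [this, Complex.re_sum]
    exact Finset.sum_congr rfl fun n hn => Xplus_mul_conj (hU n hn) (hV n hn)
  -- The damping −2|V|² minus the ½|V|² spent on R' by Young leaves −3/2; the R' terms themselves go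
  -- into 2QA.
  have bound : ∀ n ∈ indices m,
      2 * ((starRingEnd ℂ) (W p n u x) * transport 1 (W p n u) x).re +
        2 * ((starRingEnd ℂ) (W p n v x) * transport (-1) (W p n v) x).re ≤
      (2 * (p + m) + k) * ‖W p n u x‖ ^ 2 + k⁻¹ * (Q * B) - 3 / 2 * ‖W p n v x‖ ^ 2 + 2 * (Q * A) +
        2 * (((starRingEnd ℂ) (W p n u x) * Xminus (W p n v) x).re +
        ((starRingEnd ℂ) (W p n v x) * Xplus (W p n u) x).re) := by
    intro n hn
    have hu' : CkAt (p + m) u x := hu.mono (by omega)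
    have hv' : CkAt (p + m) v x := hv.mono (by omega)
    set U := W p n u x
    set V := W p n v x
    set R := W p n (Xop (-Complex.I) v) x - Xop (-Complex.I) (W p n v) x with hR
    set R' := W p n (Xop Complex.I u) x - Xop Complex.I (W p n u) x with hR'
    have hRb : ‖R‖ ^ 2 ≤ Q * B := hB ▸ hcomm p n hn _ (by simp) v x hv
    have hRb' : ‖R'‖ ^ 2 ≤ Q * A := hA ▸ hcomm p n hn _ (by simp) u x hu
    have EU : transport 1 (W p n u) x =
        ((p + n.1 - n.2.1 + c₁ : ℝ) : ℂ) * U + Xminus (W p n v) x + R := by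
      have h1 := W_transport hn 1 hu
      rw [W_congr eu, W_add hn (hu'.const_mul _) (by rw [Xminus_eq]; exact hv.xop _),
        W_const_mul hn _ hu', Xminus_eq] at h1
      rw [hR, Xminus_eq]
      push_cast
      linear_combination -h1
    have EV : transport (-1) (W p n v) x =
        ((-(p + n.1 - n.2.1 - c₂) : ℝ) : ℂ) * V + Xplus (W p n u) x + R' := by
      have h1 := W_transport hn (-1) hv
      rw [W_congr ev, W_add hn (hv'.const_mul _) (by rw [Xplus_eq]; exact hu.xop _),
        W_const_mul hn _ hv', Xplus_eq] at h1
      rw [hR', Xplus_eq]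
      push_cast
      linear_combination -h1
    have sq (r : ℝ) (a : ℂ) : ((starRingEnd ℂ) a * (r * a)).re = r * ‖a‖ ^ 2 := by
      rw [← Complex.normSq_eq_norm_sq, Complex.normSq_apply]
      simp [Complex.mul_re]; ring
    rw [EU, EV, mul_add, mul_add, mul_add, mul_add, Complex.add_re, Complex.add_re, Complex.add_re,
      Complex.add_re, sq, sq]
    have i1 := two_mul_re_le U R hk0
    have i2 := two_mul_re_le V R' (k := 1 / 2) (by norm_num)
    have hdeg := mem_indices_iff.1 hn
    have hq : (n.1 : ℝ) + n.2.1 ≤ m := by exact_mod_cast (by omega : n.1 + n.2.1 ≤ m)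
    have hp : (m : ℝ) + 2 ≤ p := by exact_mod_cast hpm
    have hn1 : (0 : ℝ) ≤ n.1 := Nat.cast_nonneg _
    have hn2 : (0 : ℝ) ≤ n.2.1 := Nat.cast_nonneg _
    have j1 : (p + n.1 - n.2.1 + c₁) * ‖U‖ ^ 2 ≤ (p + m) * ‖U‖ ^ 2 :=
      mul_le_mul_of_nonneg_right (by linarith) (sq_nonneg _)
    have j2 : -(p + n.1 - n.2.1 - c₂) * ‖V‖ ^ 2 ≤ -1 * ‖V‖ ^ 2 :=
      mul_le_mul_of_nonneg_right (by linarith) (sq_nonneg _)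
    have j3 : k⁻¹ * ‖R‖ ^ 2 ≤ k⁻¹ * (Q * B) := by gcongr
    rw [one_div, inv_inv] at i2
    linarith
  have total := Finset.sum_le_sum bound
  rw [Finset.sum_add_distrib, ← tA, ← tB] at total
  simp only [Finset.sum_add_distrib, Finset.sum_sub_distrib, ← Finset.mul_sum, Finset.sum_const,
    nsmul_eq_mul, ← hA, ← hB, ← hN] at total
  rw [tS, Finset.sum_add_distrib]
  have hkk : N * (k⁻¹ * (Q * B)) ≤ 1 / 2 * B := by
    have : N * Q * k⁻¹ ≤ 1 / 2 := by
      rw [← div_eq_mul_inv, div_le_iff₀ hk0, hk]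
      nlinarith
    calc N * (k⁻¹ * (Q * B)) = N * Q * k⁻¹ * B := by ring
      _ ≤ _ := by gcongr
  nlinarith

/-! ### Integration over SU(2), slices and slabs -/

theorem oneParam_add (j : Fin 3) (s t : ℝ) : oneParam j (s + t) = oneParam j s * oneParam j t := by
  apply Subtype.ext
  have h : ((s + t : ℝ) : ℂ) / 2 = (s : ℂ) / 2 + (t : ℂ) / 2 := by push_cast; ring
  have hI := Complex.I_sq
  simp only [oneParam, Submonoid.coe_mul, oneParamMatrix, h, Complex.sin_add, Complex.cos_add]
  ext a b
  fin_cases j <;> fin_cases a <;> fin_cases b <;>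
    simp [pauli, Matrix.mul_apply, Fin.sum_univ_two] <;> grind

theorem flow_add (i : Dir) (x : Pt) (s t : ℝ) : flow i x (s + t) = flow i (flow i x s) t := by
  cases i <;> simp [flow, oneParam_add, add_assoc, mul_assoc]

theorem CkAt.hasDerivAt_flow {f : Field} {i : Dir} {x : Pt} {s : ℝ} (hf : CkAt 1 f (flow i x s)) :
    HasDerivAt (fun t => f (flow i x t)) (FGauge.pd i f (flow i x s)) s := by
  have h := hf.hasDerivAt i
  rw [← sub_self s] at h
  have := HasDerivAt.comp_sub_const s s h
  simpa [← flow_add] using this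

theorem integral_flow {f : Field} {i : Dir} {x : Pt} {a b : ℝ} (hab : a ≤ b)
    (hf : ∀ s ∈ Icc a b, CkAt 1 f (flow i x s)) :
    ∫ s in Ioo a b, pd i f (flow i x s) = f (flow i x b) - f (flow i x a) := by
  rw [← integral_Ioc_eq_integral_Ioo, ← intervalIntegral.integral_of_le hab]
  refine intervalIntegral.integral_eq_sub_of_hasDerivAt (f := fun s => f (flow i x s)) ?_ ?_
  · intro s hs
    exact (hf s (by rwa [uIcc_of_le hab] at hs)).hasDerivAt_flow
  · refine ContinuousOn.intervalIntegrable fun s hs => ContinuousAt.continuousWithinAt ?_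
    have h0 : CkAt 0 (pd i f) (flow i x s) := (hf s (by rwa [uIcc_of_le hab] at hs)).pd i
    exact ContinuousAt.comp (f := flow i x) h0.continuousAt (continuous_flow_right i x).continuousAt

instance instIsProbabilityMeasureHaarSU2 : IsProbabilityMeasure haarSU2 := ⟨haarSU2_univ⟩

instance instIsHaarMeasureHaarSU2 : haarSU2.IsHaarMeasure := by
  unfold haarSU2; infer_instance

/-- A compact group is unimodular: a right translate of the Haar probability measure is again one,
and it is unique. Left-invariant fields generate right translations, so this is the invariance
needed to integrate by parts. -/
instance instIsMulRightInvariantHaarSU2 : haarSU2.IsMulRightInvariant where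
  map_mul_right_eq_self g := by
    have : IsProbabilityMeasure (haarSU2.map (· * g)) :=
      Measure.isProbabilityMeasure_map (measurable_mul_const g).aemeasurable
    exact Measure.isHaarMeasure_eq_of_isProbabilityMeasure _ _

/-- Integrate Z_j f(g exp(s u_j)) over s ∈ (0, 1) and g. Integrating in s first gives f(g exp u_j) −
f(g), which has integral zero by right invariance; integrating in g first gives ∫ Z_j f for every s.
-/
theorem integral_Z_eq_zero {f : Field} {τ ρ : ℝ} (j : Fin 3)
    (hf : ∀ g : SU2, CkAt 1 f (τ, ρ, g)) : ∫ g, Z j f (τ, ρ, g) ∂haarSU2 = 0 := by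
  have hc : Continuous fun g : SU2 => Z j f (τ, ρ, g) := continuous_iff_continuousAt.2 fun g => by
    have h0 : CkAt 0 (pd (.z j) f) (τ, ρ, g) := (hf g).pd (.z j)
    exact ContinuousAt.comp (f := fun g : SU2 => ((τ, ρ, g) : Pt)) h0.continuousAt
      (by fun_prop)
  have hfc : Continuous fun g : SU2 => f (τ, ρ, g) := continuous_iff_continuousAt.2 fun g =>
    ContinuousAt.comp (f := fun g : SU2 => ((τ, ρ, g) : Pt)) (hf g).continuousAt (by fun_prop)
  have hint : ∀ {h : SU2 → ℂ}, Continuous h → Integrable h haarSU2 := fun hh =>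
    hh.integrable_of_hasCompactSupport (HasCompactSupport.of_compactSpace _)
  have h1 : ∀ g : SU2, ∫ s in Ioo (0 : ℝ) 1, Z j f (τ, ρ, g * oneParam j s) =
      f (τ, ρ, g * oneParam j 1) - f (τ, ρ, g) := fun g => by
    have := integral_flow (f := f) (i := .z j) (x := (τ, ρ, g)) zero_le_one fun s _ => hf _
    simpa [flow, pd, oneParam_zero] using this
  have h2 : ∫ g, ∫ s in Ioo (0 : ℝ) 1, Z j f (τ, ρ, g * oneParam j s) ∂volume ∂haarSU2 = 0 := by
    simp only [h1]
    have hfm : Continuous fun g : SU2 => f (τ, ρ, g * oneParam j 1) :=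
      hfc.comp (continuous_mul_const (oneParam j 1))
    rw [integral_sub (hint hfm) (hint hfc),
      integral_mul_right_eq_self (fun g => f (τ, ρ, g)), sub_self]
  have hcc : Continuous fun y : SU2 × ℝ => Z j f (τ, ρ, y.1 * oneParam j y.2) := by
    have := continuous_oneParam j
    exact hc.comp (f := fun y : SU2 × ℝ => y.1 * oneParam j y.2) (by fun_prop)
  have hI : Integrable (fun y : SU2 × ℝ => Z j f (τ, ρ, y.1 * oneParam j y.2))
      (haarSU2.prod (volume.restrict (Ioo 0 1))) := by
    have : IntegrableOn (fun y : SU2 × ℝ => Z j f (τ, ρ, y.1 * oneParam j y.2))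
        (univ ×ˢ Icc 0 1) (haarSU2.prod volume) :=
      hcc.continuousOn.integrableOn_compact (isCompact_univ.prod isCompact_Icc)
    have h' := this.mono_set (prod_mono_right (s := univ)
      (Ioo_subset_Icc_self (a := (0 : ℝ)) (b := 1)))
    rwa [IntegrableOn, ← Measure.prod_restrict, Measure.restrict_univ] at h'
  rw [integral_integral_swap hI] at h2
  simp only [integral_mul_right_eq_self (fun g => Z j f (τ, ρ, g))] at h2
  simpa using h2

/-- The measure `dρ dμ` on `(0, P) × SU(2)`. -/
def sliceMeasure (P : ℝ) : Measure (ℝ × SU2) := (volume.restrict (Ioo 0 P)).prod haarSU2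

/-- The measure `dτ dρ dμ` on `(a, T) × (0, P) × SU(2)`. -/
def slabMeasure (a T P : ℝ) : Measure Pt := (volume.restrict (Ioo a T)).prod (sliceMeasure P)

theorem sliceMeasure_eq (P : ℝ) :
    sliceMeasure P = ((volume : Measure ℝ).prod haarSU2).restrict (Ioo 0 P ×ˢ univ) := by
  rw [← Measure.prod_restrict, Measure.restrict_univ, sliceMeasure]

theorem slabMeasure_eq (a T P : ℝ) :
    slabMeasure a T P = dv.restrict (Ioo a T ×ˢ (Ioo 0 P ×ˢ univ)) := by
  rw [slabMeasure, sliceMeasure_eq, Measure.prod_restrict, dv]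

instance instSFiniteSliceMeasure (P : ℝ) : SFinite (sliceMeasure P) := by
  unfold sliceMeasure; infer_instance

instance instIsFiniteMeasureOnCompactsDv : IsFiniteMeasureOnCompacts dv := by
  unfold dv; infer_instance

theorem integrable_slice {P : ℝ} {E : Type*} [NormedAddCommGroup E] {f : ℝ × SU2 → E}
    (hf : Continuous f) : Integrable f (sliceMeasure P) := by
  rw [sliceMeasure_eq]
  have : IntegrableOn f (Icc 0 P ×ˢ univ) ((volume : Measure ℝ).prod haarSU2) :=
    hf.continuousOn.integrableOn_compact (isCompact_Icc.prod isCompact_univ)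
  exact this.mono_set (prod_mono_left Ioo_subset_Icc_self)

theorem integrable_slab {a T P : ℝ} {E : Type*} [NormedAddCommGroup E] {f : Pt → E}
    (hf : ∀ x : Pt, x.1 ∈ Icc a T → ContinuousAt f x) : Integrable f (slabMeasure a T P) := by
  rw [slabMeasure_eq]
  have : IntegrableOn f (Icc a T ×ˢ (Icc 0 P ×ˢ univ)) dv :=
    ContinuousOn.integrableOn_compact (isCompact_Icc.prod (isCompact_Icc.prod isCompact_univ))
      fun x hx => (hf x hx.1).continuousWithinAt
  exact this.mono_set (prod_mono Ioo_subset_Icc_self (prod_mono_left Ioo_subset_Icc_self))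

theorem continuous_slice {E : Type*} [TopologicalSpace E] {f : Pt → E} {τ : ℝ}
    (hf : ∀ y, ContinuousAt f (τ, y)) : Continuous fun y => f (τ, y) :=
  continuous_iff_continuousAt.2 fun y =>
    ContinuousAt.comp (f := fun y : ℝ × SU2 => ((τ, y) : Pt)) (hf y) (by fun_prop)

section Slab

variable {a T P : ℝ} {f : Field} (hf : ∀ x : Pt, x.1 ∈ Icc a T → CkAt 1 f x)
include hf

theorem integrable_slab_pd (i : Dir) : Integrable (pd i f) (slabMeasure a T P) :=
  integrable_slab fun x hx => CkAt.continuousAt (k := 0) ((hf x hx).pd i)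

theorem integral_slab_dτ (haT : a ≤ T) : ∫ x, dτ f x ∂slabMeasure a T P =
    ∫ y, (f (T, y) - f (a, y)) ∂sliceMeasure P := by
  have hi : Integrable (dτ f) (slabMeasure a T P) := integrable_slab_pd hf .τ
  rw [slabMeasure] at hi ⊢
  rw [integral_prod_symm _ hi]
  refine integral_congr_ae (Filter.Eventually.of_forall fun y => ?_)
  have := integral_flow (f := f) (i := .τ) (x := (0, y)) haT
    fun s hs => hf _ (by simpa [flow] using hs)
  simpa [flow, pd] using this

theorem integral_slab_dρ (hP : 0 ≤ P) (h0 : ∀ τ ∈ Icc a T, ∀ g, f (τ, 0, g) = 0)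
    (h1 : ∀ τ ∈ Icc a T, ∀ g, f (τ, P, g) = 0) : ∫ x, dρ f x ∂slabMeasure a T P = 0 := by
  have hi : Integrable (dρ f) (slabMeasure a T P) := integrable_slab_pd hf .ρ
  rw [slabMeasure] at hi ⊢
  rw [integral_prod _ hi]
  refine setIntegral_eq_zero_of_forall_eq_zero fun τ hτ => ?_
  have hτ' := Ioo_subset_Icc_self hτ
  have hs : Integrable (fun y => dρ f (τ, y)) (sliceMeasure P) :=
    integrable_slice (continuous_slice fun y => CkAt.continuousAt (k := 0) ((hf (τ, y) hτ').pd .ρ))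
  rw [sliceMeasure] at hs ⊢
  rw [integral_prod_symm _ hs]
  refine integral_eq_zero_of_ae (Filter.Eventually.of_forall fun g => ?_)
  have := integral_flow (f := f) (i := .ρ) (x := (τ, 0, g)) hP fun s hs => hf _ hτ'
  simpa [flow, pd, h0 τ hτ' g, h1 τ hτ' g] using this

theorem integral_slab_Z (j : Fin 3) : ∫ x, Z j f x ∂slabMeasure a T P = 0 := by
  have hi : Integrable (Z j f) (slabMeasure a T P) := integrable_slab_pd hf (.z j)
  rw [slabMeasure] at hi ⊢
  rw [integral_prod _ hi]
  refine setIntegral_eq_zero_of_forall_eq_zero fun τ hτ => ?_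
  have hτ' := Ioo_subset_Icc_self hτ
  have hs : Integrable (fun y => Z j f (τ, y)) (sliceMeasure P) :=
    integrable_slice (continuous_slice fun y =>
      CkAt.continuousAt (k := 0) ((hf (τ, y) hτ').pd (.z j)))
  rw [sliceMeasure] at hs ⊢
  rw [integral_prod _ hs]
  exact integral_eq_zero_of_ae (Filter.Eventually.of_forall fun ρ =>
    integral_Z_eq_zero j fun g => hf _ hτ')

theorem integral_slab_Xop (c : ℂ) : ∫ x, Xop c f x ∂slabMeasure a T P = 0 := by
  have h0 : Integrable (Z 0 f) (slabMeasure a T P) := integrable_slab_pd hf (.z 0)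
  have h1 : Integrable (Z 1 f) (slabMeasure a T P) := integrable_slab_pd hf (.z 1)
  simp only [Xop]
  rw [integral_neg, integral_add h1 (h0.const_mul c), integral_const_mul, integral_slab_Z hf,
    integral_slab_Z hf]
  simp

end Slab

theorem integral_re_eq {α : Type*} [MeasurableSpace α] {μ : Measure α} {f : α → ℂ}
    (hf : Integrable f μ) : ∫ x, (f x).re ∂μ = (∫ x, f x ∂μ).re :=
  Complex.reCLM.integral_comp_comm hf

/-- Divergence theorem on a slab. The flux through ρ = 0 vanishes thanks to the factor ρ, that
through ρ = P by assumption, the X₊ term by invariance, and the flux through τ = T has a good sign,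
which leaves only the data at τ = a. -/
theorem integral_energy_le {a T P : ℝ} (ha : -1 < a) (haT : a ≤ T) (hT : T < 1) (hP : 0 ≤ P)
    {A B S : Field} (hA : ∀ x : Pt, x.1 ∈ Icc a T → CkAt 1 A x)
    (hB : ∀ x : Pt, x.1 ∈ Icc a T → CkAt 1 B x) (hS : ∀ x : Pt, x.1 ∈ Icc a T → CkAt 1 S x)
    (hA0 : ∀ x, 0 ≤ (A x).re) (hB0 : ∀ x, 0 ≤ (B x).re)
    (hAP : ∀ τ ∈ Icc a T, ∀ g, A (τ, P, g) = 0) (hBP : ∀ τ ∈ Icc a T, ∀ g, B (τ, P, g) = 0)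
    (h : ∀ x : Pt, x.1 ∈ Ioo a T → x.2.1 ∈ Ioo 0 P →
      (transport 1 A x).re + (transport (-1) B x).re ≤
        -(A x).re - (B x).re + 2 * (Xplus S x).re) :
    ∫ x, ((A x).re + (B x).re) ∂slabMeasure a T P ≤
      2 * ∫ y, ((A (a, y)).re + (B (a, y)).re) ∂sliceMeasure P := by
  -- The zero-order terms ±A and ±B from differentiating the coefficients cancel, so the sum of the
  -- two transport terms is exactly ∂_τ h₁ + ∂_ρ h₂.
  set h₁ : Field := fun x => (1 + 1 * x.1) * A x + (1 + (-1) * x.1) * B x with hh₁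
  set h₂ : Field := fun x => x.2.1 * (B x - A x) with hh₂
  have c1 : ∀ x : Pt, x.1 ∈ Icc a T → CkAt 1 h₁ x := fun x hx =>
    (((CkAt.const 1).add (CkAt.coordτ.const_mul 1)).mul (hA x hx)).add
      (((CkAt.const 1).add (CkAt.coordτ.const_mul (-1))).mul (hB x hx))
  have c2 : ∀ x : Pt, x.1 ∈ Icc a T → CkAt 1 h₂ x := fun x hx =>
    CkAt.coordρ.mul ((hB x hx).sub (hA x hx))
  have div : ∀ x : Pt, x.1 ∈ Icc a T →
      dτ h₁ x + dρ h₂ x = transport 1 A x + transport (-1) B x := by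
    intro x hx
    have eτ (σ : ℂ) : pd .τ (fun y : Pt => 1 + σ * y.1) x = σ := by
      have := (((hasDerivAt_id (0 : ℝ)).const_add x.1).ofReal_comp).const_mul σ
      rw [pd_eq]
      simpa [flow] using (this.const_add 1).deriv
    have eρ : pd .ρ (fun y : Pt => (y.2.1 : ℂ)) x = 1 := by
      have := ((hasDerivAt_id (0 : ℝ)).const_add x.2.1).ofReal_comp
      rw [pd_eq]
      simpa [flow] using this.deriv
    have cτ (σ : ℂ) : CkAt 1 (fun y : Pt => 1 + σ * y.1) x :=
      (CkAt.const 1).add (CkAt.coordτ.const_mul σ)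
    have d1 : dτ h₁ x = _ := pd_add .τ ((cτ 1).mul (hA x hx)) ((cτ (-1)).mul (hB x hx))
    have d2 : dρ h₂ x = _ := pd_mul .ρ CkAt.coordρ ((hB x hx).sub (hA x hx))
    rw [d1, d2, pd_mul .τ (cτ 1) (hA x hx), pd_mul .τ (cτ (-1)) (hB x hx), eτ, eτ, eρ,
      pd_sub .ρ (hB x hx) (hA x hx)]
    simp only [pd, transport]
    ring
  have iA : Integrable A (slabMeasure a T P) := integrable_slab fun x hx => (hA x hx).continuousAt
  have iB : Integrable B (slabMeasure a T P) := integrable_slab fun x hx => (hB x hx).continuousAt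
  have i1 : Integrable (dτ h₁) (slabMeasure a T P) := integrable_slab_pd c1 .τ
  have i2 : Integrable (dρ h₂) (slabMeasure a T P) := integrable_slab_pd c2 .ρ
  have iX : Integrable (Xplus S) (slabMeasure a T P) :=
    integrable_slab fun x hx => CkAt.continuousAt (k := 0) ((hS x hx).xop _)
  have sl (f : Field) (hf : ∀ x : Pt, x.1 ∈ Icc a T → CkAt 1 f x) (τ : ℝ) (hτ : τ ∈ Icc a T) :
      Integrable (fun y => f (τ, y)) (sliceMeasure P) :=
    integrable_slice (continuous_slice fun y => (hf (τ, y) hτ).continuousAt)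
  have haI : a ∈ Icc a T := left_mem_Icc.2 haT
  have hTI : T ∈ Icc a T := right_mem_Icc.2 haT
  have iD : Integrable (fun x => -(dτ h₁ x + dρ h₂ x)) (slabMeasure a T P) := (i1.add i2).neg
  have iDX : Integrable (fun x => -(dτ h₁ x + dρ h₂ x) + 2 * Xplus S x) (slabMeasure a T P) :=
    iD.add (iX.const_mul 2)
  have iE : Integrable (fun y => -(h₁ (T, y) - h₁ (a, y))) (sliceMeasure P) :=
    ((sl h₁ c1 T hTI).sub (sl h₁ c1 a haI)).neg
  have key : ∫ x, ((A x).re + (B x).re) ∂slabMeasure a T P ≤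
      ∫ x, (-(dτ h₁ x + dρ h₂ x) + 2 * Xplus S x).re ∂slabMeasure a T P := by
    refine integral_mono_ae (iA.re.add iB.re) iDX.re ?_
    rw [slabMeasure_eq]
    refine (ae_restrict_iff' (measurableSet_Ioo.prod (measurableSet_Ioo.prod .univ))).2
      (Filter.Eventually.of_forall fun x hx => ?_)
    have := h x hx.1 hx.2.1
    beta_reduce
    rw [div x (Ioo_subset_Icc_self hx.1)]
    simp only [Complex.add_re, Complex.neg_re, Complex.mul_re, Complex.re_ofNat, Complex.im_ofNat]
    linarith
  refine key.trans ?_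
  rw [integral_re_eq iDX, integral_add iD (iX.const_mul 2), integral_neg, integral_add i1 i2,
    integral_slab_dτ c1 haT, integral_slab_dρ c2 hP (fun τ _ g => by simp [h₂])
      (fun τ hτ g => by simp [h₂, hAP τ hτ g, hBP τ hτ g]), integral_const_mul, Xplus_eq,
    integral_slab_Xop hS, mul_zero, add_zero, add_zero, ← integral_neg, ← integral_re_eq iE,
    ← integral_const_mul]
  -- At τ = T both coefficients 1 ± T are nonnegative and the term is dropped; at τ = a both 1 ± a
  -- are at most 2, whence the factor 2.
  refine integral_mono iE.re
    (((sl A hA a haI).re.add (sl B hB a haI).re).const_mul 2) fun y => ?_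
  have r (τ : ℝ) : (h₁ (τ, y)).re = (1 + τ) * (A (τ, y)).re + (1 - τ) * (B (τ, y)).re := by
    have : h₁ (τ, y) = ((1 + τ : ℝ) : ℂ) * A (τ, y) + ((1 - τ : ℝ) : ℂ) * B (τ, y) := by
      simp only [h₁]; push_cast; ring
    rw [this, Complex.add_re, Complex.re_ofReal_mul, Complex.re_ofReal_mul]
  have p1 := mul_nonneg (by linarith : 0 ≤ 1 + T) (hA0 (T, y))
  have p2 := mul_nonneg (by linarith : 0 ≤ 1 - T) (hB0 (T, y))
  have p3 := mul_nonneg (by linarith : 0 ≤ 1 - a) (hA0 (a, y))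
  have p4 := mul_nonneg (by linarith : 0 ≤ 1 + a) (hB0 (a, y))
  simp only [Complex.neg_re, Complex.sub_re, r]
  linarith

/-! ### The exponential weight and the characteristic cutoffs -/

theorem transport_ofReal {k : ℝ → ℝ → ℝ} {x : Pt} {kτ kρ : ℝ} (σ : ℝ)
    (hτ : HasDerivAt (fun s => k s x.2.1) kτ x.1) (hρ : HasDerivAt (fun s => k x.1 s) kρ x.2.1) :
    transport σ (fun y => (k y.1 y.2.1 : ℂ)) x =
      (((1 + σ * x.1) * kτ - σ * x.2.1 * kρ : ℝ) : ℂ) := by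
  have h1 : dτ (fun y => (k y.1 y.2.1 : ℂ)) x = kτ := hτ.ofReal_comp.deriv
  have h2 : dρ (fun y => (k y.1 y.2.1 : ℂ)) x = kρ := hρ.ofReal_comp.deriv
  rw [transport, h1, h2]
  push_cast
  ring

theorem CkAt.ofReal {k : ℕ} {x : Pt} {F : ℝ × ℝ → ℝ} (hF : ContDiff ℝ k F) :
    CkAt k (fun y => (F (y.1, y.2.1) : ℂ)) x :=
  CkAt.of_contDiff (F := fun y => (F y : ℂ)) (Complex.ofRealCLM.contDiff.comp hF)

/-- The exponential weight. -/
def expWeight (l a τ : ℝ) : ℝ := Real.exp (-(l * (τ - a)))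

/-- The cutoff near the outer boundary `ρ (1 + τ) = c`. -/
def outerCut (c δ τ ρ : ℝ) : ℝ := Real.smoothTransition ((c - ρ * (1 + τ)) / δ - 1)

/-- The cutoff near the inner boundary `ρ = 0` or `τ = 1`. -/
def innerCut (δ τ ρ : ℝ) : ℝ := Real.smoothTransition (ρ * (1 - τ) / δ - 1)

/-- The weight in the energy estimate. -/
def weight (l a c δ τ ρ : ℝ) : ℝ := expWeight l a τ * (outerCut c δ τ ρ * innerCut δ τ ρ)

section Weight

variable {l a c δ τ ρ : ℝ}

theorem hasDerivAt_smoothTransition (s : ℝ) :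
    HasDerivAt Real.smoothTransition (deriv Real.smoothTransition s) s :=
  ((Real.smoothTransition.contDiff (n := 1)).differentiable (by simp) s).hasDerivAt

theorem deriv_smoothTransition_nonneg (s : ℝ) : 0 ≤ deriv Real.smoothTransition s :=
  Real.smoothTransition.monotone.deriv_nonneg

theorem outerCut_nonneg : 0 ≤ outerCut c δ τ ρ := Real.smoothTransition.nonneg _
theorem innerCut_nonneg : 0 ≤ innerCut δ τ ρ := Real.smoothTransition.nonneg _
theorem expWeight_nonneg : 0 ≤ expWeight l a τ := (Real.exp_pos _).le

theorem weight_nonneg : 0 ≤ weight l a c δ τ ρ :=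
  mul_nonneg expWeight_nonneg (mul_nonneg outerCut_nonneg innerCut_nonneg)

theorem weight_le_one (hl : 0 ≤ l) (hτ : a ≤ τ) : weight l a c δ τ ρ ≤ 1 := by
  have h1 : expWeight l a τ ≤ 1 := Real.exp_le_one_iff.2 (by nlinarith)
  have h2 : outerCut c δ τ ρ ≤ 1 := Real.smoothTransition.le_one _
  have h3 : innerCut δ τ ρ ≤ 1 := Real.smoothTransition.le_one _
  exact mul_le_one₀ h1 (mul_nonneg outerCut_nonneg innerCut_nonneg)
    (mul_le_one₀ h2 innerCut_nonneg h3)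

theorem weight_eq_zero (hδ : 0 < δ) (h : c - δ ≤ ρ * (1 + τ) ∨ ρ * (1 - τ) ≤ δ) :
    weight l a c δ τ ρ = 0 := by
  rcases h with h | h
  · have : outerCut c δ τ ρ = 0 :=
      Real.smoothTransition.zero_of_nonpos (by rw [sub_nonpos, div_le_one hδ]; linarith)
    simp [weight, this]
  · have : innerCut δ τ ρ = 0 :=
      Real.smoothTransition.zero_of_nonpos (by rw [sub_nonpos, div_le_one hδ]; linarith)
    simp [weight, this]

theorem weight_eq_expWeight (hδ : 0 < δ) (h1 : ρ * (1 + τ) ≤ c - 2 * δ)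
    (h2 : 2 * δ ≤ ρ * (1 - τ)) : weight l a c δ τ ρ = expWeight l a τ := by
  have e1 : outerCut c δ τ ρ = 1 :=
    Real.smoothTransition.one_of_one_le (by rw [le_sub_iff_add_le, le_div_iff₀ hδ]; linarith)
  have e2 : innerCut δ τ ρ = 1 :=
    Real.smoothTransition.one_of_one_le (by rw [le_sub_iff_add_le, le_div_iff₀ hδ]; linarith)
  simp [weight, e1, e2]

theorem contDiff_expWeight {n : ℕ} : ContDiff ℝ n fun y : ℝ × ℝ => expWeight l a y.1 := by
  unfold expWeight; fun_prop

theorem contDiff_outerCut {n : ℕ} : ContDiff ℝ n fun y : ℝ × ℝ => outerCut c δ y.1 y.2 :=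
  (Real.smoothTransition.contDiff (n := n)).comp
    (f := fun y : ℝ × ℝ => (c - y.2 * (1 + y.1)) / δ - 1) (by fun_prop)

theorem contDiff_innerCut {n : ℕ} : ContDiff ℝ n fun y : ℝ × ℝ => innerCut δ y.1 y.2 :=
  (Real.smoothTransition.contDiff (n := n)).comp
    (f := fun y : ℝ × ℝ => y.2 * (1 - y.1) / δ - 1) (by fun_prop)

theorem hasDerivAt_expWeight (τ : ℝ) :
    HasDerivAt (expWeight l a) (-l * expWeight l a τ) τ := by
  have h : HasDerivAt (fun s => -(l * (s - a))) (-(l * 1)) τ :=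
    (((hasDerivAt_id τ).sub_const a).const_mul l).neg
  refine h.exp.congr_deriv ?_
  rw [expWeight]
  ring

/-- The weight as a field. -/
def weightField (l a c δ : ℝ) : Field := fun x => (weight l a c δ x.1 x.2.1 : ℂ)

theorem CkAt.weightField {k : ℕ} {x : Pt} : CkAt k (weightField l a c δ) x :=
  CkAt.ofReal (F := fun y => weight l a c δ y.1 y.2)
    (contDiff_expWeight.mul (contDiff_outerCut.mul contDiff_innerCut))

/-- T₊ annihilates ρ(1+τ) and T₋ annihilates ρ(1−τ), so each operator sees only one cutoff. T₋
increases ρ(1+τ) at rate 2ρ and `outerCut` decreases in it; T₊ decreases ρ(1−τ) at rate 2ρ and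
`innerCut` increases in it. Both contributions are nonpositive for ρ ≥ 0 whatever δ is, and only the
exponential decay remains in the bounds. -/
theorem exists_transport_weightField (x : Pt) (hδ : 0 < δ) (hρ : 0 ≤ x.2.1) :
    (∃ r : ℝ, transport 1 (weightField l a c δ) x = r ∧
      r ≤ -(l * (1 + x.1)) * weight l a c δ x.1 x.2.1) ∧
    ∃ r : ℝ, transport (-1) (weightField l a c δ) x = r ∧
      r ≤ -(l * (1 - x.1)) * weight l a c δ x.1 x.2.1 := by
  have cE : CkAt 1 (fun y => (expWeight l a y.1 : ℂ)) x :=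
    CkAt.ofReal (F := fun y => expWeight l a y.1) contDiff_expWeight
  have cO : CkAt 1 (fun y => (outerCut c δ y.1 y.2.1 : ℂ)) x :=
    CkAt.ofReal (F := fun y => outerCut c δ y.1 y.2) contDiff_outerCut
  have cI : CkAt 1 (fun y => (innerCut δ y.1 y.2.1 : ℂ)) x :=
    CkAt.ofReal (F := fun y => innerCut δ y.1 y.2) contDiff_innerCut
  have e : weightField l a c δ = fun y => (expWeight l a y.1 : ℂ) *
      ((outerCut c δ y.1 y.2.1 : ℂ) * (innerCut δ y.1 y.2.1 : ℂ)) := by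
    funext y; simp [weightField, weight]
  have tE (σ : ℝ) := transport_ofReal (k := fun τ _ => expWeight l a τ) (x := x) σ
    (hasDerivAt_expWeight x.1) (hasDerivAt_const _ _)
  set dO := deriv Real.smoothTransition ((c - x.2.1 * (1 + x.1)) / δ - 1) with hdO
  set dI := deriv Real.smoothTransition (x.2.1 * (1 - x.1) / δ - 1) with hdI
  have hO0 : 0 ≤ dO := deriv_smoothTransition_nonneg _
  have hI0 : 0 ≤ dI := deriv_smoothTransition_nonneg _
  have tO (σ : ℝ) := transport_ofReal (k := outerCut c δ) (x := x) σ
    ((hasDerivAt_smoothTransition _).comp x.1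
      ((((((hasDerivAt_id x.1).const_add 1).const_mul x.2.1).const_sub c).div_const δ).sub_const 1))
    ((hasDerivAt_smoothTransition _).comp x.2.1
      (((((hasDerivAt_id x.2.1).mul_const (1 + x.1)).const_sub c).div_const δ).sub_const 1))
  have tI (σ : ℝ) := transport_ofReal (k := innerCut δ) (x := x) σ
    ((hasDerivAt_smoothTransition _).comp x.1
      (((((hasDerivAt_id x.1).const_sub 1).const_mul x.2.1).div_const δ).sub_const 1))
    ((hasDerivAt_smoothTransition _).comp x.2.1
      ((((hasDerivAt_id x.2.1).mul_const (1 - x.1)).div_const δ).sub_const 1))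
  have hE : 0 ≤ expWeight l a x.1 := expWeight_nonneg
  have hO : 0 ≤ outerCut c δ x.1 x.2.1 := outerCut_nonneg
  have hI : 0 ≤ innerCut δ x.1 x.2.1 := innerCut_nonneg
  have q : 0 ≤ x.2.1 / δ := by positivity
  refine ⟨⟨-(l * (1 + x.1)) * weight l a c δ x.1 x.2.1 - expWeight l a x.1 *
      (outerCut c δ x.1 x.2.1 * (2 * (x.2.1 / δ) * dI)), ?_, ?_⟩,
    ⟨-(l * (1 - x.1)) * weight l a c δ x.1 x.2.1 - expWeight l a x.1 *
      (innerCut δ x.1 x.2.1 * (2 * (x.2.1 / δ) * dO)), ?_, ?_⟩⟩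
  · have t1 := tE 1
    have t2 := tO 1
    have t3 := tI 1
    simp only [Complex.ofReal_one] at t1 t2 t3
    rw [e, transport_mul _ cE (cO.mul cI), transport_mul _ cO cI, t1, t2, t3]
    simp only [← hdO, ← hdI, weight]
    push_cast
    ring
  · have := mul_nonneg hE (mul_nonneg hO (mul_nonneg (mul_nonneg zero_le_two q) hI0))
    linarith
  · have t1 := tE (-1)
    have t2 := tO (-1)
    have t3 := tI (-1)
    simp only [Complex.ofReal_neg, Complex.ofReal_one] at t1 t2 t3
    rw [e, transport_mul _ cE (cO.mul cI), transport_mul _ cO cI, t1, t2, t3]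
    simp only [← hdO, ← hdI, weight]
    push_cast
    ring
  · have := mul_nonneg hE (mul_nonneg hI (mul_nonneg (mul_nonneg zero_le_two q) hO0))
    linarith

theorem Xop_weightField (b : ℂ) (x : Pt) : Xop b (weightField l a c δ) x = 0 := by
  simp [Xop, Z, weightField]

theorem Xplus_weightField_mul {S : Field} {x : Pt} (hS : CkAt 1 S x) :
    (Xplus (fun y => weightField l a c δ y * S y) x).re =
      weight l a c δ x.1 x.2.1 * (Xplus S x).re := by
  rw [Xplus_eq, Xplus_eq, Xop_mul _ CkAt.weightField hS, Xop_weightField, zero_mul, zero_add,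
    weightField, Complex.re_ofReal_mul]

theorem transport_weightField_mul_re {A : Field} {x : Pt} {σ : ℂ} {r : ℝ} (hA : CkAt 1 A x)
    (hr : transport σ (weightField l a c δ) x = r) :
    (transport σ (fun y => weightField l a c δ y * A y) x).re =
      r * (A x).re + weight l a c δ x.1 x.2.1 * (transport σ A x).re := by
  rw [transport_mul _ CkAt.weightField hA, hr, weightField, Complex.add_re, Complex.re_ofReal_mul,
    Complex.re_ofReal_mul]

end Weight

/-! ### The weighted estimate inside the domain -/

/-- The domain `N_t` in terms of `c = ρ_max (1 + τ)`. -/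
def region (a t c : ℝ) : Set Pt := {x | a ≤ x.1 ∧ x.1 ≤ t ∧ 0 ≤ x.2.1 ∧ x.2.1 * (1 + x.1) ≤ c}

/-- The part of the domain on which the weight with parameter `δ` has no cutoff. -/
def innerRegion (a t c δ : ℝ) : Set Pt :=
  {x | a < x.1 ∧ x.1 < t - δ ∧ x.2.1 * (1 + x.1) ≤ c - 2 * δ ∧ 2 * δ ≤ x.2.1 * (1 - x.1)}

theorem measurableSet_innerRegion (a t c δ : ℝ) : MeasurableSet (innerRegion a t c δ) := by
  have h1 : MeasurableSet {x : Pt | x.2.1 * (1 + x.1) ≤ c - 2 * δ} :=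
    measurableSet_le (by fun_prop) measurable_const
  have h2 : MeasurableSet {x : Pt | 2 * δ ≤ x.2.1 * (1 - x.1)} :=
    measurableSet_le measurable_const (by fun_prop)
  exact (measurableSet_lt measurable_const measurable_fst).inter
    ((measurableSet_lt measurable_fst measurable_const).inter (h1.inter h2))

/-- Two real fields `A`, `B` and a flux `S` that satisfy an energy inequality in `region a t c`. -/
structure EnergyInequality (C₀ a t c : ℝ) (A B S : Field) : Prop where
  ckA : ∀ x ∈ region a t c, x.1 < 1 → 0 < x.2.1 → CkAt 1 A x
  ckB : ∀ x ∈ region a t c, x.1 < 1 → 0 < x.2.1 → CkAt 1 B x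
  ckS : ∀ x ∈ region a t c, x.1 < 1 → 0 < x.2.1 → CkAt 1 S x
  nonnegA : ∀ x, 0 ≤ (A x).re
  nonnegB : ∀ x, 0 ≤ (B x).re
  le : ∀ x : Pt, a < x.1 → x.1 < t → 0 < x.2.1 → x.2.1 * (1 + x.1) < c →
    (transport 1 A x).re + (transport (-1) B x).re ≤
      C₀ * (A x).re - (B x).re + 2 * (Xplus S x).re

section Weighted

variable {C₀ a t c δ : ℝ} {A B S : Field}

theorem eventually_weight_eq_zero (l a : ℝ) (hδ : 0 < δ) {x : Pt}
    (h : ¬(x.2.1 * (1 + x.1) < c ∧ 0 < x.2.1 * (1 - x.1))) :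
    ∀ᶠ y : Pt in 𝓝 x, weight l a c δ y.1 y.2.1 = 0 := by
  rcases not_and_or.1 h with h | h
  · have hc : ContinuousAt (fun y : Pt => y.2.1 * (1 + y.1)) x := by fun_prop
    filter_upwards [hc.eventually (Ioi_mem_nhds (by linarith : c - δ < x.2.1 * (1 + x.1)))]
      with y hy
    exact weight_eq_zero hδ (.inl (le_of_lt hy))
  · have hc : ContinuousAt (fun y : Pt => y.2.1 * (1 - y.1)) x := by fun_prop
    filter_upwards [hc.eventually (Iio_mem_nhds (by linarith : x.2.1 * (1 - x.1) < δ))] with y hy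
    exact weight_eq_zero hδ (.inr (le_of_lt hy))

/-- Where the fields may fail to be regular, namely beyond or on the outer boundary and for ρ ≤ 0,
the weight vanishes in a full neighbourhood. The product is therefore C¹ on the whole slab,
including ρ outside the domain. -/
theorem ckAt_weightField_mul {f : Field} (ht : t ≤ 1) (hδ : 0 < δ) (l : ℝ)
    (hf : ∀ x ∈ region a t c, x.1 < 1 → 0 < x.2.1 → CkAt 1 f x) (x : Pt)
    (hx : x.1 ∈ Icc a (t - δ)) : CkAt 1 (fun y => weightField l a c δ y * f y) x := by
  have hx2 := hx.2
  by_cases h : x.2.1 * (1 + x.1) < c ∧ 0 < x.2.1 * (1 - x.1)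
  · have hρ : 0 < x.2.1 := pos_of_mul_pos_left h.2 (by linarith)
    exact CkAt.weightField.mul (hf x ⟨hx.1, by linarith, hρ.le, h.1.le⟩ (by linarith) hρ)
  · refine (CkAt.const 0).congr ?_
    filter_upwards [eventually_weight_eq_zero l a hδ h] with y hy
    simp [weightField, hy]

/-- The weight gains −l(1+τ)A ≤ −(C₀+1)A, which turns C₀A into −A. The gain −l(1−τ)B is merely
nonpositive and is discarded, since −B is already present. -/
theorem weighted_inequality (h : EnergyInequality C₀ a t c A B S) (ha : -1 < a) (hC₀ : 0 ≤ C₀)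
    (ht : t ≤ 1) (hδ : 0 < δ) {l : ℝ} (hl : l = (C₀ + 1) / (1 + a)) {x : Pt}
    (hx : x.1 ∈ Ioo a (t - δ)) :
    0 ≤ x.2.1 →
    (transport 1 (fun y => weightField l a c δ y * A y) x).re +
      (transport (-1) (fun y => weightField l a c δ y * B y) x).re ≤
        -(weightField l a c δ x * A x).re - (weightField l a c δ x * B x).re +
          2 * (Xplus (fun y => weightField l a c δ y * S y) x).re := by
  intro hρ0
  have hx1 := hx.1
  have hx2 := hx.2
  by_cases hg : x.2.1 * (1 + x.1) < c ∧ 0 < x.2.1 * (1 - x.1)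
  · have hρ : 0 < x.2.1 := pos_of_mul_pos_left hg.2 (by linarith)
    have hr : x ∈ region a t c := ⟨hx1.le, by linarith, hρ.le, hg.1.le⟩
    have hA := h.ckA x hr (by linarith) hρ
    have hB := h.ckB x hr (by linarith) hρ
    have hS := h.ckS x hr (by linarith) hρ
    obtain ⟨⟨r, e1, hr1⟩, r', e2, hr2⟩ :=
      exists_transport_weightField (l := l) (a := a) (c := c) x hδ hρ.le
    rw [transport_weightField_mul_re hA e1, transport_weightField_mul_re hB e2,
      Xplus_weightField_mul hS, weightField, Complex.re_ofReal_mul, Complex.re_ofReal_mul]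
    set w := weight l a c δ x.1 x.2.1
    have hw : 0 ≤ w := weight_nonneg
    have hA0 := h.nonnegA x
    have hB0 := h.nonnegB x
    have hle := mul_le_mul_of_nonneg_left (h.le x hx1 (by linarith) hρ hg.1) hw
    have hl0 : 0 ≤ l := hl ▸ by
      have : 0 < 1 + a := by linarith
      positivity
    -- The choice of l is dictated by the smallest value 1 + a of 1 + τ; this is how the constant
    -- depends on the initial time.
    have hl1 : C₀ + 1 ≤ l * (1 + x.1) := by
      have : C₀ + 1 = l * (1 + a) := by rw [hl]; field_simp [(by linarith : 1 + a ≠ 0)]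
      rw [this]
      exact mul_le_mul_of_nonneg_left (by linarith) hl0
    have k1 : r * (A x).re ≤ -(C₀ + 1) * w * (A x).re := by
      refine mul_le_mul_of_nonneg_right (hr1.trans ?_) hA0
      exact mul_le_mul_of_nonneg_right (by linarith) hw
    have k2 : r' * (B x).re ≤ 0 := by
      refine mul_nonpos_of_nonpos_of_nonneg (hr2.trans ?_) hB0
      exact mul_nonpos_of_nonpos_of_nonneg
        (neg_nonpos.2 (mul_nonneg hl0 (by linarith))) hw
    linarith
  · have e (f : Field) : (fun y => weightField l a c δ y * f y) =ᶠ[𝓝 x] fun _ => 0 := by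
      filter_upwards [eventually_weight_eq_zero l a hδ hg] with y hy
      simp [weightField, hy]
    have eA : weightField l a c δ x * A x = 0 := (e A).self_of_nhds
    have eB : weightField l a c δ x * B x = 0 := (e B).self_of_nhds
    rw [transport_congr (e A), transport_congr (e B), Xplus_eq, Xop_congr (e S), eA, eB]
    simp [transport, Xop, dτ, dρ, Z]

/-- The slab estimate is applied to the weighted fields and the weight is then removed. The constant
does not involve δ, t or c, which permits the limit δ → 0. -/
theorem lintegral_innerRegion_le (h : EnergyInequality C₀ a t c A B S) (ha : -1 < a) (hC₀ : 0 ≤ C₀)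
    (ht : t ≤ 1) (hc : 0 < c) (hδ : 0 < δ) {l : ℝ} (hl : l = (C₀ + 1) / (1 + a)) :
    ∫⁻ x in innerRegion a t c δ, ENNReal.ofReal ((A x).re + (B x).re) ∂dv ≤
      ENNReal.ofReal (2 * Real.exp (2 * l)) *
        ∫⁻ y, ENNReal.ofReal ((A (a, y)).re + (B (a, y)).re) ∂sliceMeasure (c / (1 + a)) := by
  by_cases haT : a ≤ t - δ
  swap
  · have : innerRegion a t c δ = ∅ := by
      ext x
      simp only [innerRegion, mem_ofPred_eq, mem_empty_iff_false, iff_false]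
      rintro ⟨h1, h2, -⟩
      linarith
    simp [this]
  have ha1 : 0 < 1 + a := by linarith
  have hl0 : 0 ≤ l := hl ▸ by positivity
  have hP : 0 < c / (1 + a) := by positivity
  set A' : Field := fun y => weightField l a c δ y * A y with hA'
  set B' : Field := fun y => weightField l a c δ y * B y with hB'
  have reA (x : Pt) : (A' x).re = weight l a c δ x.1 x.2.1 * (A x).re := Complex.re_ofReal_mul _ _
  have reB (x : Pt) : (B' x).re = weight l a c δ x.1 x.2.1 * (B x).re := Complex.re_ofReal_mul _ _
  have pA (x : Pt) : 0 ≤ (A' x).re := reA x ▸ mul_nonneg weight_nonneg (h.nonnegA x)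
  have pB (x : Pt) : 0 ≤ (B' x).re := reB x ▸ mul_nonneg weight_nonneg (h.nonnegB x)
  have cA := ckAt_weightField_mul ht hδ l h.ckA
  have cB := ckAt_weightField_mul ht hδ l h.ckB
  -- The slab is as wide as the initial slice, and ρ(1+τ) ≥ c on its outer face for τ ≥ a.
  have hout (τ : ℝ) (hτ : τ ∈ Icc a (t - δ)) : weight l a c δ τ (c / (1 + a)) = 0 := by
    refine weight_eq_zero hδ (.inl ?_)
    have : c = c / (1 + a) * (1 + a) := by field_simp
    have h2 : c / (1 + a) * (1 + a) ≤ c / (1 + a) * (1 + τ) :=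
      mul_le_mul_of_nonneg_left (by linarith [hτ.1]) hP.le
    linarith
  have main := integral_energy_le (P := c / (1 + a)) ha haT (by linarith) hP.le cA cB
    (ckAt_weightField_mul ht hδ l h.ckS) pA pB
    (fun τ hτ g => by simp [weightField, hout τ hτ])
    (fun τ hτ g => by simp [weightField, hout τ hτ])
    fun x hx hx' => weighted_inequality h ha hC₀ ht hδ hl hx hx'.1.le
  have iAB : Integrable (fun x => (A' x).re + (B' x).re) (slabMeasure a (t - δ) (c / (1 + a))) :=
    (integrable_slab (f := A') fun x hx => (cA x hx).continuousAt).re.add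
      (integrable_slab (f := B') fun x hx => (cB x hx).continuousAt).re
  have iS : Integrable (fun y => (A' (a, y)).re + (B' (a, y)).re) (sliceMeasure (c / (1 + a))) :=
    (integrable_slice (continuous_slice fun y =>
      (cA (a, y) (left_mem_Icc.2 haT)).continuousAt)).re.add
    (integrable_slice (continuous_slice fun y =>
      (cB (a, y) (left_mem_Icc.2 haT)).continuousAt)).re
  have hsub : innerRegion a t c δ ⊆ Ioo a (t - δ) ×ˢ (Ioo 0 (c / (1 + a)) ×ˢ univ) := by
    rintro x ⟨h1, h2, h3, h4⟩
    have hρ : 0 < x.2.1 := pos_of_mul_pos_left (lt_of_lt_of_le (by linarith) h4) (by linarith)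
    refine ⟨⟨h1, h2⟩, ⟨hρ, ?_⟩, mem_univ _⟩
    rw [lt_div_iff₀ ha1]
    have := mul_le_mul_of_nonneg_left (by linarith : 1 + a ≤ 1 + x.1) hρ.le
    linarith
  calc ∫⁻ x in innerRegion a t c δ, ENNReal.ofReal ((A x).re + (B x).re) ∂dv
      ≤ ∫⁻ x in innerRegion a t c δ, ENNReal.ofReal (Real.exp (2 * l)) *
          ENNReal.ofReal ((A' x).re + (B' x).re) ∂dv := by
        refine setLIntegral_mono' (measurableSet_innerRegion a t c δ) ?_
        rintro x ⟨h1, h2, h3, h4⟩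
        rw [← ENNReal.ofReal_mul (Real.exp_pos _).le]
        refine ENNReal.ofReal_le_ofReal ?_
        rw [reA, reB, weight_eq_expWeight hδ h3 h4, ← mul_add, ← mul_assoc, expWeight,
          ← Real.exp_add]
        refine le_mul_of_one_le_left (add_nonneg (h.nonnegA x) (h.nonnegB x)) ?_
        refine Real.one_le_exp ?_
        -- Since −1 < a and τ < 1, the elapsed time is less than 2, so the exponential weight is at
        -- least e^{−2l}.
        have : l * (x.1 - a) ≤ l * 2 := mul_le_mul_of_nonneg_left (by linarith) hl0
        linarith
    _ = ENNReal.ofReal (Real.exp (2 * l)) *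
          ∫⁻ x in innerRegion a t c δ, ENNReal.ofReal ((A' x).re + (B' x).re) ∂dv :=
        lintegral_const_mul' _ _ ENNReal.ofReal_ne_top
    _ ≤ ENNReal.ofReal (Real.exp (2 * l)) *
          ∫⁻ x, ENNReal.ofReal ((A' x).re + (B' x).re) ∂slabMeasure a (t - δ) (c / (1 + a)) := by
        rw [slabMeasure_eq]
        gcongr
    _ = ENNReal.ofReal (Real.exp (2 * l)) *
          ENNReal.ofReal (∫ x, ((A' x).re + (B' x).re) ∂slabMeasure a (t - δ) (c / (1 + a))) := by
        rw [ofReal_integral_eq_lintegral_ofReal iAB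
          (Filter.Eventually.of_forall fun x => add_nonneg (pA x) (pB x))]
    _ ≤ ENNReal.ofReal (Real.exp (2 * l)) * ENNReal.ofReal
          (2 * ∫ y, ((A' (a, y)).re + (B' (a, y)).re) ∂sliceMeasure (c / (1 + a))) := by
        gcongr
    _ = ENNReal.ofReal (2 * Real.exp (2 * l)) *
          ∫⁻ y, ENNReal.ofReal ((A' (a, y)).re + (B' (a, y)).re) ∂sliceMeasure (c / (1 + a)) := by
        rw [← ofReal_integral_eq_lintegral_ofReal iS
            (Filter.Eventually.of_forall fun y => add_nonneg (pA _) (pB _)),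
          ← ENNReal.ofReal_mul (Real.exp_pos _).le, ← ENNReal.ofReal_mul (by positivity)]
        congr 1
        ring
    _ ≤ _ := by
        refine mul_le_mul_right (lintegral_mono fun y => ENNReal.ofReal_le_ofReal ?_) _
        rw [reA, reB]
        exact add_le_add (mul_le_of_le_one_left (h.nonnegA _) (weight_le_one hl0 le_rfl))
          (mul_le_of_le_one_left (h.nonnegB _) (weight_le_one hl0 le_rfl))

end Weighted

/-! ### Exhaustion of the domain -/

/-- The part of the boundary of the domain that is missed by the interior regions. -/
def boundary (a t c : ℝ) : Set Pt :=
  {x | x.1 = a ∨ x.1 = t} ∪ {x | x.2.1 = 0 ∨ x.2.1 = c / (1 + x.1)}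

theorem dv_boundary (a t c : ℝ) : dv (boundary a t c) = 0 := by
  refine measure_union_null ?_ ?_
  · have : {x : Pt | x.1 = a ∨ x.1 = t} = ({a, t} : Set ℝ) ×ˢ univ := by
      ext x; simp
    rw [this, dv, Measure.prod_prod, (Set.toFinite _).measure_zero, zero_mul]
  · have hm : MeasurableSet {x : Pt | x.2.1 = 0 ∨ x.2.1 = c / (1 + x.1)} :=
      (measurableSet_eq_fun (by fun_prop) (by fun_prop)).union
        (measurableSet_eq_fun (by fun_prop) (by fun_prop))
    rw [dv, Measure.measure_prod_null hm]
    refine Filter.Eventually.of_forall fun τ => ?_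
    have : Prod.mk τ ⁻¹' {x : Pt | x.2.1 = 0 ∨ x.2.1 = c / (1 + x.1)} =
        ({0, c / (1 + τ)} : Set ℝ) ×ˢ univ := by
      ext x; simp
    simp only [Pi.zero_apply]
    rw [this, Measure.prod_prod, (Set.toFinite _).measure_zero, zero_mul]

theorem region_subset {a t c : ℝ} (ha : -1 < a) (ht : t ≤ 1) :
    region a t c ⊆ (⋃ k : ℕ, innerRegion a t c (1 / ((k : ℝ) + 1))) ∪ boundary a t c := by
  rintro x ⟨h1, h2, h3, h4⟩
  by_cases hb : x ∈ boundary a t c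
  · exact .inr hb
  refine .inl ?_
  simp only [boundary, mem_union, mem_ofPred_eq, not_or] at hb
  obtain ⟨⟨b1, b2⟩, b3, b4⟩ := hb
  have h1' : a < x.1 := lt_of_le_of_ne h1 (Ne.symm b1)
  have h2' : x.1 < t := lt_of_le_of_ne h2 b2
  have h3' : 0 < x.2.1 := lt_of_le_of_ne h3 (Ne.symm b3)
  have h4' : x.2.1 * (1 + x.1) < c := by
    refine lt_of_le_of_ne h4 fun h => b4 ?_
    rw [eq_div_iff (by linarith)]
    exact h
  have h5 : 0 < x.2.1 * (1 - x.1) := mul_pos h3' (by linarith)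
  -- An interior point satisfies all strict inequalities; 1/(k+1) is taken below each slack, halved
  -- where 2δ occurs.
  obtain ⟨k, hk⟩ := exists_nat_one_div_lt
    (lt_min (sub_pos.2 h2') (lt_min (half_pos (sub_pos.2 h4')) (half_pos h5)))
  simp only [lt_min_iff] at hk
  exact mem_iUnion.2 ⟨k, h1', by linarith, by linarith, by linarith⟩

/-- The inner regions for δ = 1/(k+1) increase to the domain up to a null set, and the bound is
uniform in k. No measurability of G is required. -/
theorem lintegral_region_le {C₀ a t c : ℝ} {A B S : Field} (h : EnergyInequality C₀ a t c A B S)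
    (ha : -1 < a) (hC₀ : 0 ≤ C₀) (ht : t ≤ 1) (hc : 0 < c) {G : Pt → ℝ≥0∞}
    (hG : ∀ x ∈ region a t c, x.1 < 1 → 0 < x.2.1 →
      G x ≤ 2 * ENNReal.ofReal ((A x).re + (B x).re)) :
    ∫⁻ x in region a t c, G x ∂dv ≤
      2 * (ENNReal.ofReal (2 * Real.exp (2 * ((C₀ + 1) / (1 + a)))) *
        ∫⁻ y, ENNReal.ofReal ((A (a, y)).re + (B (a, y)).re) ∂sliceMeasure (c / (1 + a))) := by
  set N : ℕ → Set Pt := fun k => innerRegion a t c (1 / ((k : ℝ) + 1)) with hN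
  have hmono : Monotone N := by
    intro k k' hk x hx
    have hδ : 1 / ((k' : ℝ) + 1) ≤ 1 / ((k : ℝ) + 1) := Nat.one_div_le_one_div hk
    obtain ⟨h1, h2, h3, h4⟩ := hx
    exact ⟨h1, by linarith, by linarith, by linarith⟩
  calc ∫⁻ x in region a t c, G x ∂dv
      ≤ ∫⁻ x in (⋃ k, N k) ∪ boundary a t c, G x ∂dv := lintegral_mono_set (region_subset ha ht)
    _ ≤ ∫⁻ x in ⋃ k, N k, G x ∂dv + ∫⁻ x in boundary a t c, G x ∂dv := lintegral_union_le _ _ _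
    _ = ⨆ k, ∫⁻ x in N k, G x ∂dv := by
        rw [setLIntegral_measure_zero _ _ (dv_boundary a t c), add_zero,
          setLIntegral_iUnion_of_directed _ hmono.directed_le]
    _ ≤ _ := by
        refine iSup_le fun k => ?_
        have hδ : 0 < 1 / ((k : ℝ) + 1) := Nat.one_div_pos_of_nat
        refine le_trans ?_ (mul_le_mul_right (lintegral_innerRegion_le h ha hC₀ ht hc hδ rfl) 2)
        rw [← lintegral_const_mul' _ _ ENNReal.ofNat_ne_top]
        refine setLIntegral_mono' (measurableSet_innerRegion _ _ _ _) fun x hx => ?_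
        obtain ⟨h1, h2, h3, h4⟩ := hx
        have hρ : 0 < x.2.1 := pos_of_mul_pos_left (lt_of_lt_of_le (by linarith) h4) (by linarith)
        exact hG x ⟨h1.le, by linarith, hρ.le, by linarith⟩ (by linarith) hρ

/-! ### Decoupling the hierarchy into two symmetric pairs -/

section Linear

variable {f g : Field} {x : Pt}

theorem transport_add_const_mul (σ s : ℂ) (hf : CkAt 1 f x) (hg : CkAt 1 g x) :
    transport σ (fun y => f y + s * g y) x = transport σ f x + s * transport σ g x := by
  have h1 := pd_add .τ hf (hg.const_mul s)
  have h2 := pd_add .ρ hf (hg.const_mul s)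
  rw [pd_const_mul _ _ hg] at h1 h2
  simp only [pd] at h1 h2
  simp only [transport, h1, h2]
  ring

theorem Xop_add_const_mul (c s : ℂ) (hf : CkAt 1 f x) (hg : CkAt 1 g x) :
    Xop c (fun y => f y + s * g y) x = Xop c f x + s * Xop c g x := by
  have h1 := pd_add (.z 0) hf (hg.const_mul s)
  have h2 := pd_add (.z 1) hf (hg.const_mul s)
  rw [pd_const_mul _ _ hg] at h1 h2
  simp only [pd] at h1 h2
  simp only [Xop, h1, h2]
  ring

variable {p m k : ℕ}

theorem CkAt.cross (hf : CkAt (p + m + k) f x) (hg : CkAt (p + m + k) g x) :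
    CkAt k (cross p m f g) x :=
  CkAt.sum fun _ hn => (hf.W hn).mul (hg.W hn).conj

theorem CkAt.energy (hf : CkAt (p + m + k) f x) : CkAt k (energy p m f) x := hf.cross hf

theorem energy_re (p m : ℕ) (f : Field) (x : Pt) :
    (energy p m f x).re = ∑ n ∈ indices m, ‖W p n f x‖ ^ 2 := by
  rw [energy_eq, Complex.ofReal_re]

theorem energy_re_nonneg (p m : ℕ) (f : Field) (x : Pt) : 0 ≤ (energy p m f x).re := by
  rw [energy_re]
  positivity

theorem density_eq (p m : ℕ) (f : Field) (x : Pt) :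
    density m (dρ^[p] f) x = ENNReal.ofReal (energy p m f x).re := by
  rw [energy_re, ENNReal.ofReal_sum_of_nonneg fun _ _ => by positivity]
  refine Finset.sum_congr rfl fun n _ => ?_
  rw [ENNReal.ofReal_pow (norm_nonneg _), ofReal_norm]
  rfl

/-- The parallelogram law. It converts between the energies of ψ₁ ± ½ψ, in which the system is
diagonal, and those of ψ₁ and ψ. -/
theorem energy_add_energy_sub (hf : CkAt (p + m) f x) (hg : CkAt (p + m) g x) :
    (energy p m (fun y => f y + (1 / 2) * g y) x).re +
      (energy p m (fun y => f y + (-(1 / 2)) * g y) x).re =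
      2 * (energy p m f x).re + 1 / 2 * (energy p m g x).re := by
  simp only [energy_re, Finset.mul_sum, ← Finset.sum_add_distrib]
  refine Finset.sum_congr rfl fun n hn => ?_
  rw [W_add hn hf (hg.const_mul _), W_add hn hf (hg.const_mul _), W_const_mul hn _ hg,
    W_const_mul hn _ hg]
  simp only [← Complex.normSq_eq_norm_sq, Complex.normSq_apply]
  simp
  ring

end Linear

section Hierarchy

variable {ψ : Field} {ψk : Fin 3 → Field} {x : Pt}

/-- This and the next three lemmas put the system in the form required by
`exists_energy_inequality`: (c₁, c₂) = (0, 1) for the pair (ψ₂, ψ₁ + ½ψ) and (−1, 0) for (ψ₁ − ½ψ,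
ψ₀). The value c₂ = 1 is the one for which p > m + 1 is used in full. -/
theorem TransportAt.transport_two (h : TransportAt ψ ψk x) (h1 : CkAt 1 (ψk 1) x)
    (hψ : CkAt 1 ψ x) : transport 1 (ψk 2) x =
      ((0 : ℝ) : ℂ) * ψk 2 x + Xminus (fun y => ψk 1 y + (1 / 2) * ψ y) x := by
  have := h.A0
  rw [Xminus_eq, Xminus_eq] at this
  rw [Xminus_eq, Xop_add_const_mul _ _ h1 hψ, transport]
  push_cast
  linear_combination this

theorem TransportAt.transport_add (h : TransportAt ψ ψk x) (h1 : CkAt 1 (ψk 1) x)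
    (hψ : CkAt 1 ψ x) : transport (-1) (fun y => ψk 1 y + (1 / 2) * ψ y) x =
      ((1 : ℝ) : ℂ) * (ψk 1 x + (1 / 2) * ψ x) + Xplus (ψk 2) x := by
  have := h.B0
  rw [transport_add_const_mul _ _ h1 hψ, transport, transport]
  push_cast
  linear_combination this

theorem TransportAt.transport_sub (h : TransportAt ψ ψk x) (h1 : CkAt 1 (ψk 1) x)
    (hψ : CkAt 1 ψ x) : transport 1 (fun y => ψk 1 y + (-(1 / 2)) * ψ y) x =
      ((-1 : ℝ) : ℂ) * (ψk 1 x + (-(1 / 2)) * ψ x) + Xminus (ψk 0) x := by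
  have := h.A1
  rw [transport_add_const_mul _ _ h1 hψ, transport, transport]
  push_cast
  linear_combination this

theorem TransportAt.transport_zero (h : TransportAt ψ ψk x) (h1 : CkAt 1 (ψk 1) x)
    (hψ : CkAt 1 ψ x) : transport (-1) (ψk 0) x =
      ((0 : ℝ) : ℂ) * ψk 0 x + Xplus (fun y => ψk 1 y + (-(1 / 2)) * ψ y) x := by
  have := h.B1
  rw [Xplus_eq, Xplus_eq] at this
  rw [Xplus_eq, Xop_add_const_mul _ _ h1 hψ, transport]
  push_cast
  linear_combination this

end Hierarchy

theorem domain_eq_region {ε ρs a t : ℝ} (ha : -1 < a) :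
    domain ε ρs a t = region a t (2 * ε / (2 - ε) * ρs) := by
  ext x
  simp only [domain, region, mem_ofPred_eq]
  refine and_congr_right fun h => and_congr_right fun _ => and_congr_right fun _ => ?_
  rw [ρmax, ← mul_div_assoc, le_div_iff₀ (by linarith)]

theorem eventually_mem_region {a t c : ℝ} {x : Pt} (h1 : a < x.1) (h2 : x.1 < t)
    (h3 : 0 < x.2.1) (h4 : x.2.1 * (1 + x.1) < c) :
    ∀ᶠ y in 𝓝 x, y ∈ region a t c ∧ y.1 < t ∧ 0 < y.2.1 := by
  have c1 : ContinuousAt (fun y : Pt => y.1) x := by fun_prop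
  have c2 : ContinuousAt (fun y : Pt => y.2.1) x := by fun_prop
  have c3 : ContinuousAt (fun y : Pt => y.2.1 * (1 + y.1)) x := by fun_prop
  filter_upwards [c1.eventually (Ioo_mem_nhds h1 h2), c2.eventually (Ioi_mem_nhds h3),
    c3.eventually (Iio_mem_nhds h4)] with y hy1 hy2 hy3
  exact ⟨⟨hy1.1.le, hy1.2.le, le_of_lt hy2, le_of_lt hy3⟩, hy1.2, hy2⟩

theorem aemeasurable_slice {p m : ℕ} {f : Field} {a P : ℝ}
    (hf : ∀ ρ ∈ Ioo 0 P, ∀ g, CkAt (p + m) f (a, ρ, g)) :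
    AEMeasurable (fun y => density m (dρ^[p] f) (a, y)) (sliceMeasure P) := by
  simp only [density_eq]
  rw [sliceMeasure_eq]
  refine ENNReal.measurable_ofReal.comp_aemeasurable ?_
  refine ContinuousOn.aemeasurable (fun y hy => ContinuousAt.continuousWithinAt ?_)
    (measurableSet_Ioo.prod .univ)
  have h : ContinuousAt (energy p m f) (a, y) := CkAt.continuousAt (k := 0) (hf y.1 hy.1 y.2).energy
  exact Complex.continuous_re.continuousAt.comp
    (ContinuousAt.comp (f := fun y : ℝ × SU2 => ((a, y) : Pt)) h (by fun_prop))

theorem lintegral_sliceMeasure_le (ε ρs a : ℝ) (m : ℕ) (f : Field) :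
    ∫⁻ y, density m f (a, y) ∂sliceMeasure (ρmax ε ρs a) ≤ sliceSq ε ρs m a f := by
  rw [sliceMeasure_eq]
  exact lintegral_mono_set (prod_mono_left Ioo_subset_Icc_self)

/-- The inequalities of the two pairs are added: A collects the components transported by T₊ and B
those transported by T₋. The factors 1 match the form f + s g of the linearity lemmas. -/
theorem energyInequality_of_transportAt {p m : ℕ} {C₀ a t c : ℝ} (ht : t ≤ 1)
    (hC : ∀ c₁ c₂ : ℝ, c₁ ≤ 0 → c₂ ≤ 1 → ∀ (u v : Field) (x : Pt),
      CkAt (p + m + 1) u x → CkAt (p + m + 1) v x →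
      (∀ᶠ y in 𝓝 x, transport 1 u y = c₁ * u y + Xminus v y) →
      (∀ᶠ y in 𝓝 x, transport (-1) v y = c₂ * v y + Xplus u y) →
      (transport 1 (energy p m u) x).re + (transport (-1) (energy p m v) x).re ≤
        C₀ * (energy p m u x).re - (energy p m v x).re + 2 * (Xplus (cross p m u v) x).re)
    {ψ : Field} {ψk : Fin 3 → Field}
    (h : ∀ x ∈ region a t c, x.1 < 1 → 0 < x.2.1 →
      CkAt (p + m + 1) ψ x ∧ (∀ k, CkAt (p + m + 1) (ψk k) x) ∧ TransportAt ψ ψk x) :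
    EnergyInequality C₀ a t c
      (fun y => energy p m (ψk 2) y + 1 * energy p m (fun y => ψk 1 y + (-(1 / 2)) * ψ y) y)
      (fun y => energy p m (fun y => ψk 1 y + (1 / 2) * ψ y) y + 1 * energy p m (ψk 0) y)
      (fun y => cross p m (ψk 2) (fun y => ψk 1 y + (1 / 2) * ψ y) y +
        1 * cross p m (fun y => ψk 1 y + (-(1 / 2)) * ψ y) (ψk 0) y) where
  ckA x hx h1 h2 := by
    obtain ⟨hψ, hk, -⟩ := h x hx h1 h2
    exact (hk 2).energy.add (((hk 1).add (hψ.const_mul _)).energy.const_mul 1)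
  ckB x hx h1 h2 := by
    obtain ⟨hψ, hk, -⟩ := h x hx h1 h2
    exact ((hk 1).add (hψ.const_mul _)).energy.add ((hk 0).energy.const_mul 1)
  ckS x hx h1 h2 := by
    obtain ⟨hψ, hk, -⟩ := h x hx h1 h2
    exact ((hk 2).cross ((hk 1).add (hψ.const_mul _))).add
      ((((hk 1).add (hψ.const_mul _)).cross (hk 0)).const_mul 1)
  nonnegA x := by
    rw [one_mul, Complex.add_re]
    exact add_nonneg (energy_re_nonneg _ _ _ _) (energy_re_nonneg _ _ _ _)
  nonnegB x := by
    rw [one_mul, Complex.add_re]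
    exact add_nonneg (energy_re_nonneg _ _ _ _) (energy_re_nonneg _ _ _ _)
  le x h1 h2 h3 h4 := by
    have ev : ∀ᶠ y in 𝓝 x, CkAt 1 ψ y ∧ CkAt 1 (ψk 1) y ∧ TransportAt ψ ψk y := by
      filter_upwards [eventually_mem_region h1 h2 h3 h4] with y hy
      obtain ⟨hψ, hk, hT⟩ := h y hy.1 (by linarith [hy.2.1]) hy.2.2
      exact ⟨hψ.mono (by omega), (hk 1).mono (by omega), hT⟩
    obtain ⟨hx, -⟩ := (eventually_mem_region h1 h2 h3 h4).self_of_nhds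
    obtain ⟨hψ, hk, -⟩ := h x hx (by linarith) h3
    have hv := (hk 1).add (hψ.const_mul (1 / 2))
    have hu := (hk 1).add (hψ.const_mul (-(1 / 2)))
    have i1 := hC 0 1 le_rfl le_rfl _ _ x (hk 2) hv
      (by filter_upwards [ev] with y hy using hy.2.2.transport_two hy.2.1 hy.1)
      (by filter_upwards [ev] with y hy using hy.2.2.transport_add hy.2.1 hy.1)
    have i2 := hC (-1) 0 (by norm_num) zero_le_one _ _ x hu (hk 0)
      (by filter_upwards [ev] with y hy using hy.2.2.transport_sub hy.2.1 hy.1)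
      (by filter_upwards [ev] with y hy using hy.2.2.transport_zero hy.2.1 hy.1)
    rw [transport_add_const_mul _ _ (hk 2).energy hu.energy,
      transport_add_const_mul _ _ hv.energy (hk 0).energy, Xplus_eq,
      Xop_add_const_mul _ _ ((hk 2).cross hv) (hu.cross (hk 0))]
    rw [Xplus_eq] at i1 i2
    simp only [one_mul, Complex.add_re]
    linarith

end FGauge

end

/-! ### The Sobolev estimate -/

theorem proposition1 (τs : ℝ) (hτs : -1 < τs) (hτs' : τs < 1) (p m : ℕ) (hpm : m + 1 < p) :
    ∃ C : ℝ, 0 < C ∧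
      ∀ (ε ρs t : ℝ), 0 < ε → ε < 1 → 0 < ρs → τs < t → t ≤ 1 →
      ∀ (ψ : FGauge.Field) (ψk : Fin 3 → FGauge.Field),
        (∀ x ∈ FGauge.domain ε ρs τs t, x.1 < 1 → 0 < x.2.1 →
          FGauge.CkAt (p + m + 1) ψ x ∧ (∀ k, FGauge.CkAt (p + m + 1) (ψk k) x) ∧
            FGauge.TransportAt ψ ψk x) →
        (∑ k, FGauge.sliceSq ε ρs m τs (FGauge.dρ^[p] (ψk k)))
            + FGauge.sliceSq ε ρs m τs (FGauge.dρ^[p] ψ) < ⊤ →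
        (∑ k, FGauge.sobolevSq m (FGauge.domain ε ρs τs t) (FGauge.dρ^[p] (ψk k)))
            + FGauge.sobolevSq m (FGauge.domain ε ρs τs t) (FGauge.dρ^[p] ψ)
          ≤ ENNReal.ofReal C *
            ((∑ k, FGauge.sliceSq ε ρs m τs (FGauge.dρ^[p] (ψk k)))
              + FGauge.sliceSq ε ρs m τs (FGauge.dρ^[p] ψ)) := by
  open FGauge in
  obtain ⟨C₀, hC₀, hC⟩ := exists_energy_inequality p m hpm
  -- The outer 2 is from bounding the full density by 2(A+B) in the domain, the inner 2 from
  -- bounding A+B by twice the density on the initial slice; between them stands the constant of the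
  -- weighted estimate.
  refine ⟨2 * (2 * Real.exp (2 * ((C₀ + 1) / (1 + τs))) * 2), by positivity, ?_⟩
  intro ε ρs t hε hε1 hρs hτt ht ψ ψk h _
  have hc : 0 < 2 * ε / (2 - ε) * ρs := by
    have : 0 < 2 - ε := by linarith
    positivity
  have hP : 2 * ε / (2 - ε) * ρs / (1 + τs) = ρmax ε ρs τs := by rw [ρmax, mul_div_assoc]
  rw [domain_eq_region hτs] at h ⊢
  have hE := energyInequality_of_transportAt ht hC h
  have split (x : Pt) (hψ : CkAt (p + m + 1) ψ x) (h1 : CkAt (p + m + 1) (ψk 1) x) :=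
    energy_add_energy_sub (p := p) (m := m) (h1.mono (Nat.le_succ _)) (hψ.mono (Nat.le_succ _))
  have bound := lintegral_region_le hE hτs hC₀ ht hc
    (G := fun x => density m (dρ^[p] (ψk 0)) x + density m (dρ^[p] (ψk 1)) x +
      density m (dρ^[p] (ψk 2)) x + density m (dρ^[p] ψ) x) (by
      intro x hx h1 h2
      obtain ⟨hψ, hk, -⟩ := h x hx h1 h2
      have e := split x hψ (hk 1)
      have n0 := energy_re_nonneg p m (ψk 0) x
      have n1 := energy_re_nonneg p m (ψk 1) x
      have n2 := energy_re_nonneg p m (ψk 2) x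
      have n := energy_re_nonneg p m ψ x
      simp only [density_eq]
      rw [← ENNReal.ofReal_add n0 n1, ← ENNReal.ofReal_add (by positivity) n2,
        ← ENNReal.ofReal_add (by positivity) n, ← ENNReal.ofReal_ofNat 2,
        ← ENNReal.ofReal_mul zero_le_two]
      refine ENNReal.ofReal_le_ofReal ?_
      simp only [one_mul, Complex.add_re]
      linarith)
  rw [hP] at bound
  have good (ρ : ℝ) (hρ : ρ ∈ Set.Ioo 0 (ρmax ε ρs τs)) (g : SU2) :
      (τs, ρ, g) ∈ region τs t (2 * ε / (2 - ε) * ρs) := by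
    refine ⟨le_rfl, hτt.le, hρ.1.le, ?_⟩
    have := hρ.2.le
    rwa [← hP, le_div_iff₀ (by linarith)] at this
  -- On the slice the integral of the sum must be bounded above by the sum of the integrals, which
  -- needs measurability of all summands but one; it comes from continuity for 0 < ρ < ρ_max.
  have meas (k : Fin 3) := aemeasurable_slice (p := p) (m := m) (f := ψk k) (a := τs)
    (P := ρmax ε ρs τs) fun ρ hρ g =>
      ((h _ (good ρ hρ g) hτs' hρ.1).2.1 k).mono (Nat.le_succ _)
  have meas₁ : AEMeasurable (fun y => density m (dρ^[p] (ψk 0)) (τs, y) +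
      density m (dρ^[p] (ψk 1)) (τs, y)) (sliceMeasure (ρmax ε ρs τs)) := (meas 0).add (meas 1)
  have meas₂ : AEMeasurable (fun y => density m (dρ^[p] (ψk 0)) (τs, y) +
      density m (dρ^[p] (ψk 1)) (τs, y) + density m (dρ^[p] (ψk 2)) (τs, y))
      (sliceMeasure (ρmax ε ρs τs)) := meas₁.add (meas 2)
  have slice : ∫⁻ y, ENNReal.ofReal (((energy p m (ψk 2) (τs, y) + 1 *
        energy p m (fun y => ψk 1 y + (-(1 / 2)) * ψ y) (τs, y)).re) +
        (energy p m (fun y => ψk 1 y + (1 / 2) * ψ y) (τs, y) +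
          1 * energy p m (ψk 0) (τs, y)).re) ∂sliceMeasure (ρmax ε ρs τs) ≤
      2 * ((∑ k, sliceSq ε ρs m τs (dρ^[p] (ψk k))) + sliceSq ε ρs m τs (dρ^[p] ψ)) := by
    calc _ ≤ ∫⁻ y, 2 * (density m (dρ^[p] (ψk 0)) (τs, y) + density m (dρ^[p] (ψk 1)) (τs, y) +
          density m (dρ^[p] (ψk 2)) (τs, y) + density m (dρ^[p] ψ) (τs, y))
            ∂sliceMeasure (ρmax ε ρs τs) := by
          rw [sliceMeasure_eq]
          refine MeasureTheory.setLIntegral_mono' (measurableSet_Ioo.prod .univ) fun y hy => ?_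
          obtain ⟨hψ, hk, -⟩ := h _ (good y.1 hy.1 y.2) hτs' hy.1.1
          have e := split _ hψ (hk 1)
          have n0 := energy_re_nonneg p m (ψk 0) (τs, y)
          have n1 := energy_re_nonneg p m (ψk 1) (τs, y)
          have n2 := energy_re_nonneg p m (ψk 2) (τs, y)
          have n := energy_re_nonneg p m ψ (τs, y)
          simp only [density_eq]
          rw [← ENNReal.ofReal_add n0 n1, ← ENNReal.ofReal_add (by positivity) n2,
            ← ENNReal.ofReal_add (by positivity) n, ← ENNReal.ofReal_ofNat 2,
            ← ENNReal.ofReal_mul zero_le_two]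
          refine ENNReal.ofReal_le_ofReal ?_
          simp only [one_mul, Complex.add_re]
          linarith
      _ ≤ _ := by
          rw [MeasureTheory.lintegral_const_mul' _ _ ENNReal.ofNat_ne_top,
            MeasureTheory.lintegral_add_left' meas₂, MeasureTheory.lintegral_add_left' meas₁,
            MeasureTheory.lintegral_add_left' (meas 0), Fin.sum_univ_three]
          gcongr <;> exact lintegral_sliceMeasure_le _ _ _ _ _
  calc _ ≤ ∫⁻ x in region τs t (2 * ε / (2 - ε) * ρs), (density m (dρ^[p] (ψk 0)) x +
          density m (dρ^[p] (ψk 1)) x + density m (dρ^[p] (ψk 2)) x + density m (dρ^[p] ψ) x)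
          ∂dv := by
        rw [Fin.sum_univ_three]
        -- In the domain only superadditivity of the lower integral is needed, which holds without
        -- measurability.
        refine le_trans ?_ (MeasureTheory.le_lintegral_add _ _)
        refine add_le_add ?_ le_rfl
        refine le_trans ?_ (MeasureTheory.le_lintegral_add _ _)
        refine add_le_add ?_ le_rfl
        exact MeasureTheory.le_lintegral_add _ _
    _ ≤ _ := bound
    _ ≤ 2 * (ENNReal.ofReal (2 * Real.exp (2 * ((C₀ + 1) / (1 + τs)))) *
          (2 * ((∑ k, sliceSq ε ρs m τs (dρ^[p] (ψk k))) + sliceSq ε ρs m τs (dρ^[p] ψ)))) := by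
        gcongr
    _ = _ := by
        generalize 2 * Real.exp (2 * ((C₀ + 1) / (1 + τs))) = E
        rw [ENNReal.ofReal_mul zero_le_two, ENNReal.ofReal_mul' zero_le_two, ENNReal.ofReal_ofNat]
        ring
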